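/- **Notation.** For a probability measure $\eta$ on $\mathbb R$ let $F_\eta(x)=\eta((-\infty,x])$, let $F_\eta(x_-)$ be its left limit at $x$, and let $F_\eta^{-1}(u)=\inf\{x\in\mathbb R: F_\eta(x)\ge u\}$ for $u\in(0,1)$. Let $\mathcal P_1(\mathbb R)$ be the set of probability measures on $\mathbb R$ with finite first moment. For $\mu,\nu\in\mathcal P_1(\mathbb R)$ write $\mu\le_{cx}\nu$ if $\int f\,d\mu\le\int f\,d\nu$ for every convex $f:\mathbb R\to\mathbb R$ (the integrals taking values in $(-\infty,+\infty]$), and $\mu<_{cx}\nu$ if moreover $\mu\ne\nu$. For probability measures $\mu,\nu$ on $\mathbb R$ or $\mathbb R^2$ with finite first moment, and a norm $\|\cdot\|$ on that space, $W_1(\mu,\nu)=\inf_P\int\|x-y\|\,P(dx,dy)$, where $P$ ranges over the couplings of $\mu$ and $\nu$; on $\mathbb R$ the norm is the absolute value. **Inverse transform martingale coupling.** Let $\mu<_{cx}\nu$ in $\mathcal P_1(\mathbb R)$. For $u\in[0,1]$ set $$\Psi_+(u)=\int_0^u(F_\mu^{-1}-F_\nu^{-1})^+(v)\,dv,\qquad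 \Psi_-(u)=\int_0^u(F_\mu^{-1}-F_\nu^{-1})^-(v)\,dv,$$ and for $u\in(0,1)$ set $$\varphi(u)=\inf\{r\in[0,1]:\Psi_-(r)\ge\Psi_+(u)\},\qquad \widetilde\varphi(u)=\inf\{r\in[0,1]:\Psi_+(r)\ge\Psi_-(u)\}.$$ Let $\widetilde m^{IT}(u,dy)$, $u\in(0,1)$, be the Markov kernel given by * $p\,\delta_{F_\nu^{-1}(\varphi(u))}+(1-p)\,\delta_{F_\nu^{-1}(u)}$ with $p=\dfrac{F_\mu^{-1}(u)-F_\nu^{-1}(u)}{F_\nu^{-1}(\varphi(u))-F_\nu^{-1}(u)}$, if $\varphi(u)<1$ and $F_\nu^{-1}(u)<F_\mu^{-1}(u)<F_\nu^{-1}(\varphi(u))$; * $q\,\delta_{F_\nu^{-1}(\widetilde\varphi(u))}+(1-q)\,\delta_{F_\nu^{-1}(u)}$ with $q=\dfrac{F_\nu^{-1}(u)-F_\mu^{-1}(u)}{F_\nu^{-1}(u)-F_\nu^{-1}(\widetilde\varphi(u))}$, if $\widetilde\varphi(u)<1$ and $F_\nu^{-1}(\widetilde\varphi(u))<F_\mu^{-1}(u)<F_\nu^{-1}(u)$;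 * $\delta_{F_\nu^{-1}(u)}$ otherwise. Let $m^{IT}(x,dy)$, $x\in\mathbb R$, be the Markov kernel equal to $\delta_x(dy)$ if $F_\mu(x)=0$ or $F_\mu(x_-)=1$; otherwise to $\frac1{\mu(\{x\})}\int_{F_\mu(x_-)}^{F_\mu(x)}\widetilde m^{IT}(u,dy)\,du$ if $\mu(\{x\})>0$, and to $\widetilde m^{IT}(F_\mu(x),dy)$ if $\mu(\{x\})=0$. The inverse transform martingale coupling between $\mu$ and $\nu$ is the probability measure $M^{IT}(dx,dy)=\mu(dx)\,m^{IT}(x,dy)$ on $\mathbb R^2$. **Proposition.** Let $\mu,\nu\in\mathcal P_1(\mathbb R)$ with $\mu<_{cx}\nu$, and let $(\mu_n)_{n\in\mathbb N}$, $(\nu_n)_{n\in\mathbb N}$ be sequences in $\mathcal P_1(\mathbb R)$ with $\mu_n<_{cx}\nu_n$ for all $n$. Let $M^{IT}_n$ and $M^{IT}$ be the inverse transform martingale couplings between $\mu_n$ and $\nu_n$ and between $\mu$ and $\nu$, respectively. If $W_1(\mu_n,\mu)\to0$ and $W_1(\nu_n,\nu)\to0$ as $n\to\infty$, then $W_1(M^{IT}_n,M^{IT})\to0$,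 for the Wasserstein distance associated with any norm on $\mathbb R^2$. -/

import Mathlib

open MeasureTheory ProbabilityTheory Set Filter Topology
open scoped ENNReal

noncomputable section

namespace ITMC

/-- The convex order `μ ≤_cx ν` for probability measures with finite first moment. The integral of
a convex function exists in `(-∞, +∞]` under such measures, and the inequality holds trivially when
its `ν`-integral is `+∞`; otherwise it says that the `μ`-integral is finite too and not larger. -/
def ConvexOrderLE (μ ν : Measure ℝ) : Prop :=
  ∀ f : ℝ → ℝ, ConvexOn ℝ univ f → Integrable f ν →
    Integrable f μ ∧ ∫ x, f x ∂μ ≤ ∫ x, f x ∂ν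

/-- The strict relation `μ <_cx ν`. -/
def ConvexOrderLT (μ ν : Measure ℝ) : Prop :=
  ConvexOrderLE μ ν ∧ μ ≠ ν

/-- The couplings of two measures `μ` and `ν` on `E`. -/
def couplings {E : Type*} [MeasurableSpace E] (μ ν : Measure E) : Set (Measure (E × E)) :=
  {P | P.fst = μ ∧ P.snd = ν}

/-- The Wasserstein distance of index one for the distance `(x, y) ↦ N (x - y)`,
where `N` is a norm on `E`. -/
def wasserstein1 {E : Type*} [MeasurableSpace E] [AddCommGroup E] [Module ℝ E]
    (N : Seminorm ℝ E) (μ ν : Measure E) : ℝ≥0∞ :=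
  ⨅ P ∈ couplings μ ν, ∫⁻ z, ENNReal.ofReal (N (z.1 - z.2)) ∂P

/-- The quantile function `F_η⁻¹(u) = inf {x | u ≤ F_η(x)}`, `0 < u < 1`. -/
def quantile (η : Measure ℝ) (u : ℝ) : ℝ :=
  sInf {x : ℝ | u ≤ cdf η x}

/-- `Ψ₊(u) = ∫₀ᵘ (F_μ⁻¹ - F_ν⁻¹)⁺`; `ENNReal.ofReal` takes the positive part. -/
def psiPos (μ ν : Measure ℝ) (u : ℝ) : ℝ≥0∞ :=
  ∫⁻ v in Ioc 0 u, ENNReal.ofReal (quantile μ v - quantile ν v)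

/-- `Ψ₋(u) = ∫₀ᵘ (F_μ⁻¹ - F_ν⁻¹)⁻`. -/
def psiNeg (μ ν : Measure ℝ) (u : ℝ) : ℝ≥0∞ :=
  ∫⁻ v in Ioc 0 u, ENNReal.ofReal (quantile ν v - quantile μ v)

/-- `φ(u) = Ψ₋⁻¹(Ψ₊(u))`. -/
def phi (μ ν : Measure ℝ) (u : ℝ) : ℝ :=
  sInf {r : ℝ | r ∈ Icc (0 : ℝ) 1 ∧ psiPos μ ν u ≤ psiNeg μ ν r}

/-- `φ̃(u) = Ψ₊⁻¹(Ψ₋(u))`. -/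
def phiTilde (μ ν : Measure ℝ) (u : ℝ) : ℝ :=
  sInf {r : ℝ | r ∈ Icc (0 : ℝ) 1 ∧ psiNeg μ ν u ≤ psiPos μ ν r}

/-- The two-point measure `p δ_x + (1 - p) δ_y`, used for `0 ≤ p ≤ 1`. -/
def twoPoint (p x y : ℝ) : Measure ℝ :=
  ENNReal.ofReal p • Measure.dirac x + ENNReal.ofReal (1 - p) • Measure.dirac y

open Classical in
/-- The measures `m̃(u, dy)`, `0 < u < 1`, of the inverse transform martingale coupling. -/
def mTildeFun (μ ν : Measure ℝ) (u : ℝ) : Measure ℝ :=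
  if quantile ν u < quantile μ u ∧ quantile μ u < quantile ν (phi μ ν u) ∧ phi μ ν u < 1 then
    twoPoint ((quantile μ u - quantile ν u) / (quantile ν (phi μ ν u) - quantile ν u))
      (quantile ν (phi μ ν u)) (quantile ν u)
  else if quantile ν (phiTilde μ ν u) < quantile μ u ∧ quantile μ u < quantile ν u ∧
      phiTilde μ ν u < 1 then
    twoPoint ((quantile ν u - quantile μ u) / (quantile ν u - quantile ν (phiTilde μ ν u)))
      (quantile ν (phiTilde μ ν u)) (quantile ν u)
  else Measure.dirac (quantile ν u)

/-! Measurability of the ingredients. -/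

theorem measurable_sInf_level {α : Type*} [LinearOrder α] [TopologicalSpace α] [OrderTopology α]
    [SecondCountableTopology α] [MeasurableSpace α] [BorelSpace α] (S : α → Set ℝ)
    (hS : Antitone S) : Measurable (fun w => sInf (S w)) := by
  classical
  let T : Set α := {w | (S w).Nonempty ∧ BddBelow (S w)}
  have hT : T.OrdConnected := by
    refine ⟨fun a ha b hb c hc => ⟨?_, ?_⟩⟩
    · exact hb.1.mono (hS hc.2)
    · exact ha.2.mono (hS hc.1)
  have hTm : MeasurableSet T := hT.measurableSet
  have h0 : ∀ w, w ∉ T → sInf (S w) = 0 := by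
    intro w hw
    by_cases h : (S w).Nonempty
    · exact Real.sInf_of_not_bddBelow fun hb => hw ⟨h, hb⟩
    · rw [Set.not_nonempty_iff_eq_empty.1 h, Real.sInf_empty]
  refine measurable_of_restrict_of_restrict_compl hTm ?_ ?_
  · have hm : Monotone (T.domRestrict fun w => sInf (S w)) := by
      intro a b hab
      exact csInf_le_csInf a.2.2 b.2.1 (hS hab)
    exact hm.measurable
  · have : Tᶜ.domRestrict (fun w => sInf (S w)) = fun _ => 0 := by
      funext w
      exact h0 w w.2
    rw [this]
    exact measurable_const

theorem measurable_quantile (η : Measure ℝ) : Measurable (quantile η) :=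
  measurable_sInf_level (fun u => {x : ℝ | u ≤ cdf η x}) fun _ _ h _ hx => le_trans h hx

theorem measurable_psiPos (μ ν : Measure ℝ) : Measurable (psiPos μ ν) := by
  refine Monotone.measurable fun a b hab => ?_
  exact lintegral_mono_set (Ioc_subset_Ioc_right hab)

theorem measurable_psiNeg (μ ν : Measure ℝ) : Measurable (psiNeg μ ν) :=
  measurable_psiPos ν μ

theorem measurable_phi (μ ν : Measure ℝ) : Measurable (phi μ ν) :=
  (measurable_sInf_level (fun w => {r : ℝ | r ∈ Icc (0 : ℝ) 1 ∧ w ≤ psiNeg μ ν r})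
    fun _ _ h _ hx => ⟨hx.1, le_trans h hx.2⟩).comp (measurable_psiPos μ ν)

theorem measurable_phiTilde (μ ν : Measure ℝ) : Measurable (phiTilde μ ν) :=
  measurable_phi ν μ

theorem measurable_twoPoint {p x y : ℝ → ℝ} (hp : Measurable p) (hx : Measurable x)
    (hy : Measurable y) : Measurable fun u => twoPoint (p u) (x u) (y u) := by
  refine Measure.measurable_of_measurable_coe _ fun s hs => ?_
  have h (z : ℝ → ℝ) (hz : Measurable z) : Measurable fun u => (Measure.dirac (z u)) s :=
    (Measure.measurable_coe hs).comp (Measure.measurable_dirac.comp hz)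
  simp only [twoPoint, Measure.coe_add, Measure.coe_smul, Pi.add_apply, Pi.smul_apply, smul_eq_mul]
  exact (hp.ennreal_ofReal.mul (h x hx)).add ((measurable_const.sub hp).ennreal_ofReal.mul (h y hy))

theorem measurable_mTildeFun (μ ν : Measure ℝ) : Measurable (mTildeFun μ ν) := by
  have hμ := measurable_quantile μ
  have hν := measurable_quantile ν
  have hφ := measurable_phi μ ν
  have hψ := measurable_phiTilde μ ν
  have hνφ : Measurable fun u => quantile ν (phi μ ν u) := hν.comp hφ
  have hνψ : Measurable fun u => quantile ν (phiTilde μ ν u) := hν.comp hψ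
  refine Measurable.ite ?_ (measurable_twoPoint ?_ hνφ hν)
    (Measurable.ite ?_ (measurable_twoPoint ?_ hνψ hν) (Measure.measurable_dirac.comp hν))
  · exact (measurableSet_lt hν hμ).inter
      ((measurableSet_lt hμ hνφ).inter (measurableSet_lt hφ measurable_const))
  · exact (hμ.sub hν).div (hνφ.sub hν)
  · exact (measurableSet_lt hνψ hμ).inter
      ((measurableSet_lt hμ hν).inter (measurableSet_lt hψ measurable_const))
  · exact (hν.sub hμ).div (hν.sub hνψ)

theorem isProbabilityMeasure_twoPoint {p x y : ℝ} (h0 : 0 ≤ p) (h1 : p ≤ 1) :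
    IsProbabilityMeasure (twoPoint p x y) := by
  refine ⟨?_⟩
  simp only [twoPoint, Measure.coe_add, Measure.coe_smul, Pi.add_apply, Pi.smul_apply, smul_eq_mul,
    measure_univ, mul_one]
  rw [← ENNReal.ofReal_add h0 (by linarith)]
  simp

/-- The Markov kernel `m̃(u, dy)`; only its values for `0 < u < 1` matter. -/
def mTilde (μ ν : Measure ℝ) : Kernel ℝ ℝ :=
  ⟨mTildeFun μ ν, measurable_mTildeFun μ ν⟩

instance (μ ν : Measure ℝ) : IsMarkovKernel (mTilde μ ν) := by
  refine ⟨fun u => ?_⟩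
  change IsProbabilityMeasure (mTildeFun μ ν u)
  unfold mTildeFun
  split_ifs with h1 h2
  · have h3 : 0 < quantile ν (phi μ ν u) - quantile ν u := by linarith [h1.1, h1.2.1]
    refine isProbabilityMeasure_twoPoint (div_nonneg (by linarith [h1.1]) h3.le) ?_
    rw [div_le_one h3]
    linarith [h1.2.1]
  · have h3 : 0 < quantile ν u - quantile ν (phiTilde μ ν u) := by linarith [h2.1, h2.2.1]
    refine isProbabilityMeasure_twoPoint (div_nonneg (by linarith [h2.2.1]) h3.le) ?_
    rw [div_le_one h3]
    linarith [h2.1]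
  · infer_instance

open Classical in
/-- The measures `m(x, dy)` obtained from a kernel `m̃(u, dy)`, with `F` the distribution function
of `μ`: `δ_x` if `F(x) = 0` or `F(x-) = 1`; otherwise `μ({x})⁻¹ ∫_{F(x-)}^{F(x)} m̃(u, dy) du` if
`μ({x}) > 0`, and `m̃(F(x), dy)` if not. -/
def mOfTildeFun (μ : Measure ℝ) (κ : Kernel ℝ ℝ) (x : ℝ) : Measure ℝ :=
  if cdf μ x = 0 ∨ Function.leftLim (cdf μ) x = 1 then Measure.dirac x
  else if 0 < μ {x} then
    (μ {x})⁻¹ • (volume.restrict (Ioc (Function.leftLim (cdf μ) x) (cdf μ x))).bind κ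
  else κ (cdf μ x)

theorem measurable_mOfTildeFun (μ : Measure ℝ) [IsProbabilityMeasure μ] (κ : Kernel ℝ ℝ) :
    Measurable (mOfTildeFun μ κ) := by
  classical
  have hF : Measurable (cdf μ) := (monotone_cdf μ).measurable
  have hL : Measurable (Function.leftLim (cdf μ)) := (monotone_cdf μ).leftLim.measurable
  have h1 : Measurable fun x => if cdf μ x = 0 ∨ Function.leftLim (cdf μ) x = 1 then
      Measure.dirac x else κ (cdf μ x) := by
    refine Measurable.ite ?_ Measure.measurable_dirac (κ.measurable.comp hF)
    exact (measurableSet_eq_fun hF measurable_const).union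
      (measurableSet_eq_fun hL measurable_const)
  refine h1.measurable_of_countable_ne ?_
  have hc : Set.Countable {x : ℝ | 0 < μ {x}} := by
    exact Measure.countable_meas_level_set_pos (μ := μ) (g := fun x : ℝ => x) measurable_id
  refine hc.mono fun x hx => ?_
  by_contra hx0
  apply hx
  have hx0' : ¬ 0 < μ {x} := hx0
  simp only [mOfTildeFun, if_neg hx0']

/-- The kernel `m(x, dy)` obtained from a kernel `m̃(u, dy)`. -/
def mOfTilde (μ : Measure ℝ) [IsProbabilityMeasure μ] (κ : Kernel ℝ ℝ) : Kernel ℝ ℝ :=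
  ⟨mOfTildeFun μ κ, measurable_mOfTildeFun μ κ⟩

instance (μ : Measure ℝ) [IsProbabilityMeasure μ] (κ : Kernel ℝ ℝ) [IsMarkovKernel κ] :
    IsMarkovKernel (mOfTilde μ κ) := by
  refine ⟨fun x => ?_⟩
  change IsProbabilityMeasure (mOfTildeFun μ κ x)
  unfold mOfTildeFun
  split_ifs with h1 h2
  · infer_instance
  · refine ⟨?_⟩
    have h3 : μ {x} = ENNReal.ofReal (cdf μ x - Function.leftLim (cdf μ) x) := by
      conv_lhs => rw [← measure_cdf μ]
      exact StieltjesFunction.measure_singleton _ _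
    rw [Measure.smul_apply, Measure.bind_apply MeasurableSet.univ κ.measurable.aemeasurable]
    simp only [measure_univ, lintegral_const, Measure.restrict_apply MeasurableSet.univ,
      univ_inter, one_mul, Real.volume_Ioc, smul_eq_mul]
    rw [← h3]
    exact ENNReal.inv_mul_cancel h2.ne' (measure_ne_top μ _)
  · infer_instance

/-- The inverse transform martingale coupling `M(dx, dy) = μ(dx) m(x, dy)`. -/
def inverseTransformCoupling (μ ν : Measure ℝ) [IsProbabilityMeasure μ] : Measure (ℝ × ℝ) :=
  μ ⊗ₘ mOfTilde μ (mTilde μ ν)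

end ITMC

end

namespace ITMC

/-! All the couplings can be built on one probability space. Let `u`, `v` be independent and uniform
on (0,1), put X = F_μ⁻¹(u), and use `v` to choose Y between the at most two atoms of m̃(u, ·). The
pair (X, Y) has law M^IT (`map_uniformPair`), so driving two such pairs by the same (u, v) bounds W₁
in the plane by a multiple of E|X_n - X| plus a multiple of E|Y_n - Y|. The first expectation is at
most W₁(μ_n, μ), because the quantile coupling is optimal on the line.

For the second, the weights p and q are such that, given u, the mean of |Y - F_ν⁻¹(u)| is at most
|F_μ⁻¹(u) - F_ν⁻¹(u)| (`jumpProb_mul_abs_le`). This yields a domination converging in L¹, so it is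
enough that the conditional cost `pairCost` tends to 0 for almost every u. Where F_μ⁻¹(u) = F_ν⁻¹(u)
the domination already gives this.

Where F_ν⁻¹(u) < F_μ⁻¹(u), the weight and the target must converge, hence φ_n(u) → φ(u) with F_ν⁻¹
continuous at φ(u). The functions Ψ± converge pointwise, so this can fail only if the level Ψ₊(u) is
one of countably many: a level where Ψ₋ is flat, or its value at a discontinuity of a quantile
function. As Ψ₊ is strictly increasing on `gapSet`, only countably many u there are bad
(`ae_psiPos_notMem`, `ae_tendsto_phi`). The convex order gives Ψ₋(u) < Ψ₊(u) = Ψ₋(φ(u)), so the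
quantiles are in reverse order somewhere in (u, φ(u)], and by monotonicity F_μ⁻¹(u) < F_ν⁻¹(φ(u)).
These strict inequalities pass to large n, so m̃_n(u, ·) is eventually given by the same formula as
m̃(u, ·).

The remaining case is symmetric: swapping μ and ν exchanges Ψ₊ with Ψ₋ and φ with φ̃. -/

/-- The uniform distribution on the open unit interval. -/
noncomputable def unitLaw : Measure ℝ := volume.restrict (Ioo 0 1)

instance : IsProbabilityMeasure unitLaw := ⟨by simp [unitLaw]⟩

theorem ae_unitLaw_mem : ∀ᵐ u ∂unitLaw, u ∈ Ioo (0 : ℝ) 1 :=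
  ae_restrict_mem measurableSet_Ioo

theorem unitLaw_Iic {p : ℝ} (h1 : p ≤ 1) : unitLaw (Iic p) = ENNReal.ofReal p := by
  rw [unitLaw, Measure.restrict_apply measurableSet_Iic]
  refine le_antisymm ?_ ?_
  · refine (measure_mono (t := Ioc 0 p) fun x hx => ⟨hx.2.1, hx.1⟩).trans ?_
    simp
  · refine le_trans ?_ (measure_mono (s := Ioo 0 p)
      fun x hx => ⟨hx.2.le, hx.1, hx.2.trans_le h1⟩)
    simp

theorem unitLaw_Ioi {p : ℝ} (h0 : 0 ≤ p) : unitLaw (Ioi p) = ENNReal.ofReal (1 - p) := by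
  rw [unitLaw, Measure.restrict_apply measurableSet_Ioi]
  have : Ioi p ∩ Ioo 0 1 = Ioo p 1 := by
    ext x
    exact ⟨fun hx => ⟨hx.1, hx.2.2⟩, fun hx => ⟨hx.1, h0.trans_lt hx.1, hx.2⟩⟩
  rw [this, Real.volume_Ioo]

/-! ### Quantile functions -/

/-- The infimum defining the quantile is attained, by right continuity of the distribution function.
-/
theorem quantile_le_iff (η : Measure ℝ) {u : ℝ} (hu : u ∈ Ioo (0 : ℝ) 1) (x : ℝ) :
    quantile η u ≤ x ↔ u ≤ cdf η x := by
  have hne : {x : ℝ | u ≤ cdf η x}.Nonempty :=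
    ((tendsto_cdf_atTop η).eventually (eventually_ge_nhds hu.2)).exists
  have hbdd : BddBelow {x : ℝ | u ≤ cdf η x} := by
    obtain ⟨b, hb⟩ := ((tendsto_cdf_atBot η).eventually (eventually_lt_nhds hu.1)).exists
    refine ⟨b, fun x hx => le_of_not_gt fun hxb => ?_⟩
    exact absurd (le_trans hx (monotone_cdf η hxb.le)) (not_le.2 hb)
  have hmem : u ≤ cdf η (quantile η u) := by
    have hr : Tendsto (cdf η) (𝓝[>] (quantile η u)) (𝓝 (cdf η (quantile η u))) :=
      ((cdf η).right_continuous _).mono_left (nhdsWithin_mono _ Ioi_subset_Ici_self)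
    refine ge_of_tendsto hr ?_
    filter_upwards [self_mem_nhdsWithin] with y hy
    obtain ⟨s, hs, hsy⟩ := exists_lt_of_csInf_lt hne hy
    exact le_trans hs (monotone_cdf η hsy.le)
  exact ⟨fun h => hmem.trans (monotone_cdf η h), fun h => csInf_le hbdd h⟩

theorem lt_quantile_iff (η : Measure ℝ) {u : ℝ} (hu : u ∈ Ioo (0 : ℝ) 1) (x : ℝ) :
    x < quantile η u ↔ cdf η x < u := by
  rw [← not_le, quantile_le_iff η hu, not_le]

theorem monotoneOn_quantile (η : Measure ℝ) : MonotoneOn (quantile η) (Ioo 0 1) := by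
  intro u hu v hv huv
  rw [quantile_le_iff η hu]
  exact huv.trans ((quantile_le_iff η hv _).1 le_rfl)

theorem map_quantile_unitLaw (η : Measure ℝ) [IsProbabilityMeasure η] :
    unitLaw.map (quantile η) = η := by
  have : IsProbabilityMeasure (unitLaw.map (quantile η)) :=
    Measure.isProbabilityMeasure_map (measurable_quantile η).aemeasurable
  refine Measure.ext_of_Iic _ _ fun x => ?_
  rw [Measure.map_apply (measurable_quantile η) measurableSet_Iic, ← ofReal_cdf η x,
    ← unitLaw_Iic (cdf_le_one η x)]
  refine measure_congr ?_
  filter_upwards [ae_unitLaw_mem] with u hu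
  exact propext (quantile_le_iff η hu x)

theorem countable_not_continuousAt_quantile (η : Measure ℝ) :
    {u ∈ Ioo (0 : ℝ) 1 | ¬ ContinuousAt (quantile η) u}.Countable := by
  refine (monotoneOn_quantile η).countable_not_continuousWithinAt.mono fun u hu => ?_
  exact ⟨hu.1, fun h => hu.2 (h.continuousAt (isOpen_Ioo.mem_nhds hu.1))⟩

theorem ae_continuousAt_quantile (η : Measure ℝ) :
    ∀ᵐ u ∂unitLaw, ContinuousAt (quantile η) u := by
  have h : ∀ᵐ u ∂unitLaw, u ∉ {u ∈ Ioo (0 : ℝ) 1 | ¬ ContinuousAt (quantile η) u} :=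
    ((countable_not_continuousAt_quantile η).ae_notMem volume).filter_mono
      (ae_mono Measure.restrict_le_self)
  filter_upwards [h, ae_unitLaw_mem] with u hu hu'
  by_contra hc
  exact hu ⟨hu', hc⟩

/-! ### The quantile coupling is optimal on the line -/

theorem lintegral_indicator_Ico (a b : ℝ) :
    ∫⁻ x, {x | a ≤ x ∧ x < b}.indicator 1 x = ENNReal.ofReal (b - a) := by
  change ∫⁻ x, (Ico a b).indicator 1 x = _
  rw [lintegral_indicator_one measurableSet_Ico, Real.volume_Ico]

/-- Layer-cake formula: (g - f)⁺ is the length of [f, g), and Tonelli exchanges the two integrals.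
-/
theorem lintegral_ofReal_sub_eq {α : Type*} [MeasurableSpace α] (P : Measure α) [SFinite P]
    {f g : α → ℝ} (hf : Measurable f) (hg : Measurable g) :
    ∫⁻ z, ENNReal.ofReal (g z - f z) ∂P = ∫⁻ x, P {z | f z ≤ x ∧ x < g z} := by
  have hm : MeasurableSet {q : α × ℝ | f q.1 ≤ q.2 ∧ q.2 < g q.1} :=
    (measurableSet_le (hf.comp measurable_fst) measurable_snd).inter
      (measurableSet_lt measurable_snd (hg.comp measurable_fst))
  simp_rw [← lintegral_indicator_Ico]
  have : Measurable (fun q : α × ℝ => {x | f q.1 ≤ x ∧ x < g q.1}.indicator (1 : ℝ → ℝ≥0∞) q.2) :=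
    (measurable_one.indicator hm : Measurable
      ({q : α × ℝ | f q.1 ≤ q.2 ∧ q.2 < g q.1}.indicator (1 : α × ℝ → ℝ≥0∞)))
  rw [lintegral_lintegral_swap this.aemeasurable]
  refine lintegral_congr fun x => ?_
  have hx : MeasurableSet {z | f z ≤ x ∧ x < g z} :=
    (measurableSet_le hf measurable_const).inter (measurableSet_lt measurable_const hg)
  rw [← lintegral_indicator_one hx]
  rfl

/-- Compare the layers at each x. The quantile coupling puts mass at most (F_μ(x) - F_ν(x))⁺ on
pairs straddling x, and no coupling puts less, because {z₁ ≤ x} is contained in {z₁ ≤ x < z₂} ∪ {z₂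
≤ x}. -/
theorem lintegral_quantile_sub_le {μ ν : Measure ℝ} [IsProbabilityMeasure μ]
    [IsProbabilityMeasure ν] {P : Measure (ℝ × ℝ)} (hP : P ∈ couplings μ ν) :
    ∫⁻ u, ENNReal.ofReal (quantile ν u - quantile μ u) ∂unitLaw ≤
      ∫⁻ z, ENNReal.ofReal (z.2 - z.1) ∂P := by
  have hPp : IsProbabilityMeasure P := by
    refine ⟨?_⟩
    rw [← preimage_univ (f := Prod.fst), ← Measure.fst_apply MeasurableSet.univ, hP.1,
      measure_univ]
  rw [lintegral_ofReal_sub_eq _ (measurable_quantile μ) (measurable_quantile ν),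
    lintegral_ofReal_sub_eq _ measurable_fst measurable_snd]
  refine lintegral_mono fun x => ?_
  have h1 : unitLaw {u | quantile μ u ≤ x ∧ x < quantile ν u} ≤
      ENNReal.ofReal (cdf μ x - cdf ν x) := by
    rw [← Real.volume_Ioc, unitLaw, Measure.restrict_apply' measurableSet_Ioo]
    refine measure_mono fun u hu => ?_
    exact ⟨(lt_quantile_iff ν hu.2 x).1 hu.1.2, (quantile_le_iff μ hu.2 x).1 hu.1.1⟩
  refine h1.trans ?_
  rw [ENNReal.ofReal_sub _ (cdf_nonneg ν x), ofReal_cdf, ofReal_cdf, tsub_le_iff_right]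
  conv_lhs => rw [← hP.1, Measure.fst_apply measurableSet_Iic]
  conv_rhs => rw [← hP.2, Measure.snd_apply measurableSet_Iic]
  refine (measure_mono fun z hz => ?_).trans (measure_union_le _ _)
  by_cases h : x < z.2
  · exact Or.inl ⟨hz, h⟩
  · exact Or.inr (not_lt.1 h)

theorem ofReal_abs_eq (a b : ℝ) :
    ENNReal.ofReal |a - b| = ENNReal.ofReal (b - a) + ENNReal.ofReal (a - b) := by
  rcases le_total a b with h | h
  · rw [abs_of_nonpos (by linarith), ENNReal.ofReal_of_nonpos (p := a - b) (by linarith), add_zero,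
      neg_sub]
  · rw [abs_of_nonneg (by linarith), ENNReal.ofReal_of_nonpos (p := b - a) (by linarith), zero_add]

theorem lintegral_abs_quantile_sub_le_wasserstein1 (μ ν : Measure ℝ) [IsProbabilityMeasure μ]
    [IsProbabilityMeasure ν] :
    ∫⁻ u, ENNReal.ofReal |quantile μ u - quantile ν u| ∂unitLaw ≤
      wasserstein1 (normSeminorm ℝ ℝ) μ ν := by
  refine le_iInf₂ fun P hP => ?_
  have hμ := measurable_quantile μ
  have hν := measurable_quantile ν
  -- The negative part of the difference is the positive part for the transposed coupling.
  have hswap : P.map Prod.swap ∈ couplings ν μ :=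
    ⟨by rw [Measure.fst_map_swap, hP.2], by rw [Measure.snd_map_swap, hP.1]⟩
  have h2 := lintegral_quantile_sub_le hswap
  rw [lintegral_map (by fun_prop) measurable_swap] at h2
  simp only [coe_normSeminorm, Real.norm_eq_abs, ofReal_abs_eq]
  rw [lintegral_add_left (by fun_prop), lintegral_add_left (by fun_prop)]
  exact add_le_add (lintegral_quantile_sub_le hP) h2

/-- Monotone functions converging in `L¹` converge along sequences of arguments tending to a
continuity point of the limit. -/
theorem tendsto_of_monotoneOn_of_lintegral_tendsto {f : ℝ → ℝ} {fs : ℕ → ℝ → ℝ}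
    (hfs : ∀ n, MonotoneOn (fs n) (Ioo 0 1))
    (hL : Tendsto (fun n => ∫⁻ u, ENNReal.ofReal |fs n u - f u| ∂unitLaw) atTop (𝓝 0))
    {w : ℝ} (hw : w ∈ Ioo (0 : ℝ) 1) (hc : ContinuousAt f w) {ws : ℕ → ℝ}
    (hws : Tendsto ws atTop (𝓝 w)) : Tendsto (fun n => fs n (ws n)) atTop (𝓝 (f w)) := by
  rw [Metric.tendsto_nhds]
  intro ε hε
  obtain ⟨d, hd, hdf⟩ := Metric.continuousAt_iff.1 hc (ε / 2) (by positivity)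
  obtain ⟨d', hd', hsub⟩ := Metric.isOpen_iff.1 isOpen_Ioo w hw
  obtain ⟨h, hh, hhd⟩ : ∃ h > 0, 2 * h ≤ min d d' :=
    ⟨min d d' / 2, by positivity, by linarith⟩
  have hpos : (0 : ℝ≥0∞) < ENNReal.ofReal (ε / 2) * ENNReal.ofReal h := by
    rw [← ENNReal.ofReal_mul (by positivity)]
    exact ENNReal.ofReal_pos.2 (by positivity)
  -- A deviation of ε/2 on an interval of length h costs a fixed amount in L¹, which is impossible
  -- for large n.
  have key : ∀ n a, Ioo a (a + h) ⊆ Metric.ball w (2 * h) →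
      (∀ s ∈ Ioo a (a + h), ε / 2 ≤ |fs n s - f s|) →
      ENNReal.ofReal (ε / 2) * ENNReal.ofReal h ≤
        ∫⁻ u, ENNReal.ofReal |fs n u - f u| ∂unitLaw := by
    intro n a ha hs
    have hsub' : Ioo a (a + h) ⊆ Ioo 0 1 := fun s hs' => hsub
      (Metric.ball_subset_ball (hhd.trans (min_le_right _ _)) (ha hs'))
    calc ENNReal.ofReal (ε / 2) * ENNReal.ofReal h
        = ∫⁻ _ in Ioo a (a + h), ENNReal.ofReal (ε / 2) := by simp
      _ ≤ ∫⁻ u in Ioo a (a + h), ENNReal.ofReal |fs n u - f u| :=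
          setLIntegral_mono' measurableSet_Ioo fun s hs' => ENNReal.ofReal_le_ofReal (hs s hs')
      _ ≤ _ := lintegral_mono_set hsub'
  filter_upwards [hL.eventually (eventually_lt_nhds hpos), Metric.tendsto_nhds.1 hws h hh]
    with n hn hwn
  rw [Real.dist_eq, abs_lt] at hwn
  have hball : ∀ s, |s - w| < 2 * h → s ∈ Ioo (0 : ℝ) 1 ∧ |f s - f w| < ε / 2 := fun s hs => by
    rw [← Real.dist_eq] at hs ⊢
    exact ⟨hsub (lt_of_lt_of_le hs (hhd.trans (min_le_right _ _))),
      hdf (lt_of_lt_of_le hs (hhd.trans (min_le_left _ _)))⟩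
  have hwn' := (hball (ws n) (abs_lt.2 ⟨by linarith, by linarith⟩)).1
  rw [Real.dist_eq, abs_lt]
  by_contra hcon
  refine absurd hn (not_lt.2 ?_)
  rw [not_and_or, not_lt, not_lt] at hcon
  rcases hcon with hcon | hcon
  -- If the value at `ws n` is too low, monotonicity keeps it too low on (w - 2h, w - h), which lies
  -- to the left of `ws n`; a value too high persists on (w + h, w + 2h).
  · refine key n (w - 2 * h) (fun s hs => ?_) fun s hs => ?_
    · rw [Metric.mem_ball, Real.dist_eq, abs_lt]
      constructor <;> linarith [hs.1, hs.2]
    · obtain ⟨h1, h2⟩ := hball s (abs_lt.2 ⟨by linarith [hs.1], by linarith [hs.2]⟩)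
      have h3 := hfs n h1 hwn' (by linarith [hs.2])
      rw [abs_lt] at h2
      exact le_trans (by linarith [h2.1]) (neg_le_abs _)
  · refine key n (w + h) (fun s hs => ?_) fun s hs => ?_
    · rw [Metric.mem_ball, Real.dist_eq, abs_lt]
      constructor <;> linarith [hs.1, hs.2]
    · obtain ⟨h1, h2⟩ := hball s (abs_lt.2 ⟨by linarith [hs.1], by linarith [hs.2]⟩)
      have h3 := hfs n hwn' h1 (by linarith [hs.1])
      rw [abs_lt] at h2
      exact le_trans (by linarith [h2.2]) (le_abs_self _)


/-! ### The functions `Ψ₊` and `Ψ₋` -/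

theorem unitLaw_restrict_Iic {u : ℝ} (hu : u ≤ 1) :
    unitLaw.restrict (Iic u) = volume.restrict (Ioc 0 u) := by
  rw [unitLaw, Measure.restrict_restrict measurableSet_Iic]
  refine Measure.restrict_congr_set (((ae_eq_refl (Iic u)).inter Ioo_ae_eq_Ioc).trans ?_)
  refine Eq.eventuallyEq ?_
  ext x
  exact ⟨fun hx => ⟨hx.2.1, hx.1⟩, fun hx => ⟨hx.2, hx.1, hx.2.trans hu⟩⟩

theorem psiPos_eq (μ ν : Measure ℝ) {u : ℝ} (hu : u ≤ 1) :
    psiPos μ ν u =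
      ∫⁻ v in Iic u, ENNReal.ofReal (quantile μ v - quantile ν v) ∂unitLaw := by
  rw [unitLaw_restrict_Iic hu, psiPos]

theorem integrable_quantile {μ : Measure ℝ} [IsProbabilityMeasure μ]
    (hμ : Integrable (fun x : ℝ => x) μ) : Integrable (quantile μ) unitLaw := by
  rw [← map_quantile_unitLaw μ] at hμ
  exact (integrable_map_measure measurable_id.aestronglyMeasurable
    (measurable_quantile μ).aemeasurable).1 hμ

theorem integral_quantile (μ : Measure ℝ) [IsProbabilityMeasure μ] {g : ℝ → ℝ}
    (hg : Measurable g) : ∫ u, g (quantile μ u) ∂unitLaw = ∫ x, g x ∂μ := by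
  conv_rhs => rw [← map_quantile_unitLaw μ]
  exact (integral_map (measurable_quantile μ).aemeasurable hg.aestronglyMeasurable).symm

theorem lintegral_abs_quantile_sub_lt_top {μ ν : Measure ℝ} [IsProbabilityMeasure μ]
    [IsProbabilityMeasure ν] (hμ : Integrable (fun x : ℝ => x) μ)
    (hν : Integrable (fun x : ℝ => x) ν) :
    ∫⁻ u, ENNReal.ofReal |quantile μ u - quantile ν u| ∂unitLaw < ∞ := by
  have := ((integrable_quantile hμ).sub (integrable_quantile hν)).hasFiniteIntegral
  rwa [hasFiniteIntegral_iff_norm] at this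

section

variable {μ ν : Measure ℝ} [IsProbabilityMeasure μ] [IsProbabilityMeasure ν]

theorem psiPos_ne_top (hμ : Integrable (fun x : ℝ => x) μ) (hν : Integrable (fun x : ℝ => x) ν)
    {u : ℝ} (hu : u ≤ 1) : psiPos μ ν u ≠ ∞ := by
  rw [psiPos_eq μ ν hu]
  refine (lt_of_le_of_lt ((setLIntegral_le_lintegral _ _).trans (lintegral_mono fun v => ?_))
    (lintegral_abs_quantile_sub_lt_top hμ hν)).ne
  exact ENNReal.ofReal_le_ofReal (le_abs_self _)

theorem continuousOn_psiPos (hμ : Integrable (fun x : ℝ => x) μ)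
    (hν : Integrable (fun x : ℝ => x) ν) : ContinuousOn (psiPos μ ν) (Icc 0 1) := by
  have hi : IntegrableOn (fun v => max (quantile μ v - quantile ν v) 0) (Icc 0 1) := by
    rw [integrableOn_Icc_iff_integrableOn_Ioo]
    exact ((integrable_quantile hμ).sub (integrable_quantile hν)).pos_part
  refine (ENNReal.continuous_ofReal.comp_continuousOn
    (intervalIntegral.continuousOn_primitive hi)).congr fun r hr => ?_
  have hr' : IntegrableOn (fun v => max (quantile μ v - quantile ν v) 0) (Ioc 0 r) :=
    hi.mono_set fun x hx => ⟨hx.1.le, hx.2.trans hr.2⟩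
  simp only [Function.comp]
  rw [ofReal_integral_eq_lintegral_ofReal hr' (ae_of_all _ fun _ => le_max_right _ _), psiPos]
  simp [ENNReal.ofReal_max]


end

theorem psiPos_mono (μ ν : Measure ℝ) : Monotone (psiPos μ ν) :=
  fun _ _ hab => lintegral_mono_set (Ioc_subset_Ioc_right hab)

theorem psiPos_add (μ ν : Measure ℝ) {a b : ℝ} (ha : 0 ≤ a) (hab : a ≤ b) :
    psiPos μ ν b =
      psiPos μ ν a + ∫⁻ v in Ioc a b, ENNReal.ofReal (quantile μ v - quantile ν v) := by
  rw [psiPos, psiPos, ← lintegral_union measurableSet_Ioc (Ioc_disjoint_Ioc_of_le le_rfl),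
    Ioc_union_Ioc_eq_Ioc ha hab]

theorem psiPos_eq_of_le {μ ν : Measure ℝ} {a b : ℝ} (ha : 0 ≤ a) (hab : a ≤ b)
    (h : ∀ v ∈ Ioc a b, quantile μ v ≤ quantile ν v) : psiPos μ ν b = psiPos μ ν a := by
  rw [psiPos_add μ ν ha hab, setLIntegral_congr_fun (g := fun _ => 0) measurableSet_Ioc
    fun v hv => ENNReal.ofReal_of_nonpos (sub_nonpos.2 (h v hv))]
  simp

theorem exists_quantile_lt_of_psiPos_lt {μ ν : Measure ℝ} {a b : ℝ} (ha : 0 ≤ a)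
    (h : psiPos μ ν a < psiPos μ ν b) :
    a < b ∧ ∃ v ∈ Ioc a b, quantile ν v < quantile μ v := by
  have hab : a < b := lt_of_not_ge fun hba => absurd h (not_lt.2 (psiPos_mono μ ν hba))
  refine ⟨hab, ?_⟩
  by_contra! hcon
  exact absurd h (psiPos_eq_of_le ha hab.le hcon).not_gt

theorem psiPos_lt_of_lt {μ ν : Measure ℝ} {a b : ℝ} (ha : 0 ≤ a) (hab : a < b)
    (hfin : psiPos μ ν a ≠ ∞) (h : ∀ v ∈ Ioc a b, quantile ν v < quantile μ v) :
    psiPos μ ν a < psiPos μ ν b := by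
  rw [psiPos_add μ ν ha hab.le]
  refine ENNReal.lt_add_right hfin (ne_of_gt ?_)
  have hm : Measurable fun v => ENNReal.ofReal (quantile μ v - quantile ν v) :=
    ((measurable_quantile μ).sub (measurable_quantile ν)).ennreal_ofReal
  rw [setLIntegral_pos_iff hm]
  have : Function.support (fun v => ENNReal.ofReal (quantile μ v - quantile ν v)) ∩ Ioc a b =
      Ioc a b := inter_eq_right.2 fun v hv => (ENNReal.ofReal_pos.2 (sub_pos.2 (h v hv))).ne'
  rw [this, Real.volume_Ioc]
  exact ENNReal.ofReal_pos.2 (sub_pos.2 hab)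

/-! ### Consequences of the convex order -/

theorem lintegral_ofReal_neg_le {α : Type*} [MeasurableSpace α] {m : Measure α} {f : α → ℝ}
    (hf : Integrable f m) (h : 0 ≤ ∫ x, f x ∂m) :
    ∫⁻ x, ENNReal.ofReal (-f x) ∂m ≤ ∫⁻ x, ENNReal.ofReal (f x) ∂m := by
  rw [integral_eq_lintegral_pos_part_sub_lintegral_neg_part hf, sub_nonneg] at h
  refine (ENNReal.toReal_le_toReal ?_ ?_).1 h
  · exact hf.neg.lintegral_lt_top.ne
  · exact hf.lintegral_lt_top.ne

section

variable {μ ν : Measure ℝ} [IsProbabilityMeasure μ] [IsProbabilityMeasure ν]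

/-- Both x and -x are convex, so the means agree. -/
theorem ConvexOrderLE.integral_quantile_eq (h : ConvexOrderLE μ ν)
    (hν : Integrable (fun x : ℝ => x) ν) :
    ∫ u, quantile μ u ∂unitLaw = ∫ u, quantile ν u ∂unitLaw := by
  rw [integral_quantile μ measurable_id', integral_quantile ν measurable_id']
  refine le_antisymm (h (fun x => x) (convexOn_id convex_univ) hν).2 ?_
  have := (h (fun x => -x) (concaveOn_id convex_univ).neg hν.neg).2
  rw [integral_neg, integral_neg] at this
  exact neg_le_neg_iff.1 this

/-- Test the order on (t - x)⁺ with t = F_ν⁻¹(r). For ν the integral is exactly that of t - F_ν⁻¹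
over (0, r], since F_ν⁻¹ crosses t at r; for μ it is at least that of t - F_μ⁻¹. -/
theorem ConvexOrderLE.setIntegral_quantile_le (h : ConvexOrderLE μ ν)
    (hμ : Integrable (fun x : ℝ => x) μ) (hν : Integrable (fun x : ℝ => x) ν)
    {r : ℝ} (hr : r ∈ Ioo (0 : ℝ) 1) :
    ∫ u in Iic r, quantile ν u ∂unitLaw ≤ ∫ u in Iic r, quantile μ u ∂unitLaw := by
  have hQμ := integrable_quantile hμ
  have hQν := integrable_quantile hν
  set t := quantile ν r
  have hconv : ConvexOn ℝ univ fun x : ℝ => max (t - x) 0 :=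
    ((convexOn_const t convex_univ).sub (concaveOn_id convex_univ)).sup
      (convexOn_const 0 convex_univ)
  have hm : Measurable fun x : ℝ => max (t - x) 0 := by fun_prop
  have hle := (h _ hconv ((integrable_const t).sub hν).pos_part).2
  rw [← integral_quantile μ hm, ← integral_quantile ν hm] at hle
  have hiμ : Integrable (fun u => max (t - quantile μ u) 0) unitLaw :=
    ((integrable_const t).sub hQμ).pos_part
  have h1 : ∫ u in Iic r, (t - quantile μ u) ∂unitLaw ≤
      ∫ u, max (t - quantile μ u) 0 ∂unitLaw :=
    (integral_mono ((integrable_const t).sub hQμ).integrableOn hiμ.integrableOn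
      fun u => le_max_left _ _).trans
      (setIntegral_le_integral hiμ (ae_of_all _ fun u => le_max_right _ _))
  have h2 : ∫ u, max (t - quantile ν u) 0 ∂unitLaw =
      ∫ u in Iic r, (t - quantile ν u) ∂unitLaw := by
    rw [← integral_indicator measurableSet_Iic]
    refine integral_congr_ae ?_
    filter_upwards [ae_unitLaw_mem] with u hu
    by_cases hur : u ≤ r
    · rw [indicator_of_mem (mem_Iic.2 hur), max_eq_left]
      exact sub_nonneg.2 (monotoneOn_quantile ν hu hr hur)
    · rw [indicator_of_notMem (by simpa using hur), max_eq_right]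
      exact sub_nonpos.2 (monotoneOn_quantile ν hr hu (not_le.1 hur).le)
  have h3 := (h1.trans hle).trans h2.le
  rw [integral_sub (integrable_const t) hQμ.integrableOn,
    integral_sub (integrable_const t) hQν.integrableOn] at h3
  linarith

theorem ConvexOrderLE.psiNeg_le_psiPos (h : ConvexOrderLE μ ν)
    (hμ : Integrable (fun x : ℝ => x) μ) (hν : Integrable (fun x : ℝ => x) ν)
    {r : ℝ} (hr : r ∈ Ioo (0 : ℝ) 1) : psiNeg μ ν r ≤ psiPos μ ν r := by
  have hQμ := integrable_quantile hμ
  have hQν := integrable_quantile hν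
  have := lintegral_ofReal_neg_le (m := unitLaw.restrict (Iic r))
    (hQμ.integrableOn.sub hQν.integrableOn) (by
      simp only [Pi.sub_apply]
      rw [integral_sub hQμ.integrableOn hQν.integrableOn]
      exact sub_nonneg.2 (h.setIntegral_quantile_le hμ hν hr))
  rw [psiPos_eq μ ν hr.2.le]
  change psiPos ν μ r ≤ _
  rw [psiPos_eq ν μ hr.2.le]
  simpa only [Pi.sub_apply, neg_sub] using this

theorem ConvexOrderLE.psiNeg_one (h : ConvexOrderLE μ ν)
    (hμ : Integrable (fun x : ℝ => x) μ) (hν : Integrable (fun x : ℝ => x) ν) :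
    psiNeg μ ν 1 = psiPos μ ν 1 := by
  have hQμ := integrable_quantile hμ
  have hQν := integrable_quantile hν
  have he := h.integral_quantile_eq hν
  have h1 := lintegral_ofReal_neg_le (hQμ.sub hQν) (by
    simp only [Pi.sub_apply]
    rw [integral_sub hQμ hQν, he, sub_self])
  have h2 := lintegral_ofReal_neg_le (hQν.sub hQμ) (by
    simp only [Pi.sub_apply]
    rw [integral_sub hQν hQμ, he, sub_self])
  simp only [Pi.sub_apply, neg_sub] at h1 h2
  have hone : ∀ f : ℝ → ℝ≥0∞, ∫⁻ v in Ioc 0 1, f v = ∫⁻ v, f v ∂unitLaw := fun f => by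
    rw [unitLaw, Measure.restrict_congr_set Ioo_ae_eq_Ioc]
  rw [psiNeg, psiPos, hone, hone]
  exact le_antisymm h1 h2

end


/-! ### Points at which the quantile functions are continuous and in strict order -/

/-- The continuity points of both quantile functions at which that of `μ` is the larger one. -/
def gapSet (μ ν : Measure ℝ) : Set ℝ :=
  {u | u ∈ Ioo (0 : ℝ) 1 ∧ ContinuousAt (quantile μ) u ∧ ContinuousAt (quantile ν) u ∧
    quantile ν u < quantile μ u}

theorem ae_mem_gapSet (μ ν : Measure ℝ) :
    ∀ᵐ u ∂unitLaw, quantile ν u < quantile μ u → u ∈ gapSet μ ν := by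
  filter_upwards [ae_unitLaw_mem, ae_continuousAt_quantile μ, ae_continuousAt_quantile ν]
    with u h1 h2 h3 h4 using ⟨h1, h2, h3, h4⟩

theorem exists_Ioc_of_mem_gapSet {μ ν : Measure ℝ} {u : ℝ} (hu : u ∈ gapSet μ ν) :
    ∃ a b, 0 < a ∧ a < u ∧ u < b ∧ b < 1 ∧ ∀ v ∈ Ioc a b, quantile ν v < quantile μ v := by
  have h : ∀ᶠ v in 𝓝 u, v ∈ Ioo (0 : ℝ) 1 ∧ quantile ν v < quantile μ v :=
    (Filter.Eventually.and (isOpen_Ioo.mem_nhds hu.1) <| hu.2.2.1.eventually_lt hu.2.1 hu.2.2.2)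
  obtain ⟨d, hd, hsub⟩ := Metric.eventually_nhds_iff.1 h
  have hsub' : ∀ v, |v - u| < d → v ∈ Ioo (0 : ℝ) 1 ∧ quantile ν v < quantile μ v :=
    fun v hv => hsub hv
  refine ⟨u - d / 2, u + d / 2, (hsub' _ ?_).1.1, by linarith, by linarith, (hsub' _ ?_).1.2,
    fun v hv => (hsub' v ?_).2⟩
  · rw [abs_lt]; constructor <;> linarith
  · rw [abs_lt]; constructor <;> linarith
  · rw [abs_lt]; constructor <;> linarith [hv.1, hv.2]

section

variable {μ ν : Measure ℝ} [IsProbabilityMeasure μ] [IsProbabilityMeasure ν]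

/-- By continuity the gap at u persists on an interval to the right of u, where Ψ₊ gains a positive
amount. -/
theorem strictMonoOn_psiPos_gapSet (hμ : Integrable (fun x : ℝ => x) μ)
    (hν : Integrable (fun x : ℝ => x) ν) : StrictMonoOn (psiPos μ ν) (gapSet μ ν) := by
  intro u hu v hv huv
  obtain ⟨a, b, -, hau, hub, -, h⟩ := exists_Ioc_of_mem_gapSet hu
  refine lt_of_lt_of_le (psiPos_lt_of_lt hu.1.1.le (lt_min hub huv)
    (psiPos_ne_top hμ hν hu.1.2.le) fun s hs => h s ⟨hau.trans hs.1, hs.2.trans (min_le_left _ _)⟩)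
    (psiPos_mono μ ν (min_le_right _ _))

/-- Ψ₊ is injective on `gapSet`, so a countable set of levels has a countable, hence null, preimage
there. This discards every exceptional level of Ψ₋ at once. -/
theorem ae_psiPos_notMem (hμ : Integrable (fun x : ℝ => x) μ)
    (hν : Integrable (fun x : ℝ => x) ν) {C : Set ℝ≥0∞} (hC : C.Countable) :
    ∀ᵐ u ∂unitLaw, quantile ν u < quantile μ u → psiPos μ ν u ∉ C := by
  have hc : (gapSet μ ν ∩ psiPos μ ν ⁻¹' C).Countable := by
    refine countable_of_injective_of_countable_image
      ((strictMonoOn_psiPos_gapSet hμ hν).injOn.mono inter_subset_left) ?_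
    exact hC.mono (by rintro _ ⟨u, hu, rfl⟩; exact hu.2)
  have h : ∀ᵐ u ∂unitLaw, u ∉ gapSet μ ν ∩ psiPos μ ν ⁻¹' C :=
    (hc.ae_notMem volume).filter_mono (ae_mono Measure.restrict_le_self)
  filter_upwards [h, ae_mem_gapSet μ ν] with u h1 h2 h3 h4
  exact h1 ⟨h2 h3, h4⟩

/-- Start from the weak inequality at a nearby point. If F_ν⁻¹ < F_μ⁻¹ near u, take the point to the
left: from there to u, Ψ₋ is flat and Ψ₊ grows. If F_μ⁻¹ < F_ν⁻¹, take it to the right: Ψ₊ is flat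
and Ψ₋ still grows after u. -/
theorem ConvexOrderLE.psiNeg_lt_psiPos (h : ConvexOrderLE μ ν)
    (hμ : Integrable (fun x : ℝ => x) μ) (hν : Integrable (fun x : ℝ => x) ν)
    {u : ℝ} (hu : u ∈ gapSet μ ν ∪ gapSet ν μ) : psiNeg μ ν u < psiPos μ ν u := by
  rcases hu with hu | hu
  · obtain ⟨a, b, ha, hau, hub, hb, hlt⟩ := exists_Ioc_of_mem_gapSet hu
    have hsub : ∀ v ∈ Ioc a u, quantile ν v < quantile μ v :=
      fun v hv => hlt v ⟨hv.1, hv.2.trans hub.le⟩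
    calc psiNeg μ ν u = psiNeg μ ν a :=
          psiPos_eq_of_le ha.le hau.le fun v hv => (hsub v hv).le
      _ ≤ psiPos μ ν a := h.psiNeg_le_psiPos hμ hν ⟨ha, by linarith⟩
      _ < psiPos μ ν u := psiPos_lt_of_lt ha.le hau (psiPos_ne_top hμ hν (by linarith)) hsub
  · obtain ⟨a, b, ha, hau, hub, hb, hlt⟩ := exists_Ioc_of_mem_gapSet hu
    have hsub : ∀ v ∈ Ioc u b, quantile μ v < quantile ν v :=
      fun v hv => hlt v ⟨hau.trans hv.1, hv.2⟩
    calc psiNeg μ ν u < psiNeg μ ν b :=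
          psiPos_lt_of_lt hu.1.1.le hub (psiPos_ne_top hν hμ (by linarith)) hsub
      _ ≤ psiPos μ ν b := h.psiNeg_le_psiPos hμ hν ⟨by linarith, hb⟩
      _ = psiPos μ ν u := psiPos_eq_of_le hu.1.1.le hub.le fun v hv => (hsub v hv).le

end

/-! ### The map `φ` -/

theorem phi_le (μ ν : Measure ℝ) {u r : ℝ} (hr : r ∈ Icc (0 : ℝ) 1)
    (h : psiPos μ ν u ≤ psiNeg μ ν r) : phi μ ν u ≤ r :=
  csInf_le ⟨0, fun _ hs => hs.1.1⟩ ⟨hr, h⟩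

/-- The witness `r` ensures that the set is nonempty; otherwise its infimum would be the default
value 0. -/
theorem le_phi (μ ν : Measure ℝ) {u a r : ℝ} (hr : r ∈ Icc (0 : ℝ) 1)
    (h : psiPos μ ν u ≤ psiNeg μ ν r) (ha : psiNeg μ ν a < psiPos μ ν u) : a ≤ phi μ ν u := by
  refine le_csInf ⟨r, hr, h⟩ fun s hs => le_of_not_gt fun hsa => ?_
  exact absurd (ha.trans_le hs.2) (psiPos_mono ν μ hsa.le).not_gt

theorem phi_mem_Icc_and_psiNeg_phi {μ ν : Measure ℝ} [IsProbabilityMeasure μ] [IsProbabilityMeasure ν]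
    (hμ : Integrable (fun x : ℝ => x) μ)
    (hν : Integrable (fun x : ℝ => x) ν) {u : ℝ} (h : psiPos μ ν u ≤ psiNeg μ ν 1) :
    phi μ ν u ∈ Icc (0 : ℝ) 1 ∧ psiNeg μ ν (phi μ ν u) = psiPos μ ν u := by
  have hcont : ContinuousOn (psiNeg μ ν) (Icc 0 1) := continuousOn_psiPos hν hμ
  have himg : psiPos μ ν u ∈ psiNeg μ ν '' Icc 0 1 := by
    refine intermediate_value_Icc zero_le_one hcont ⟨?_, h⟩
    rw [psiNeg, Ioc_self]
    simp
  -- By the intermediate value theorem the level is hit exactly at some r. Compactness makes the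
  -- infimum a member of the set, and it is at most r, so the level is hit exactly there too.
  obtain ⟨r, hr, hru⟩ := himg
  have hcomp : IsCompact {r : ℝ | r ∈ Icc (0 : ℝ) 1 ∧ psiPos μ ν u ≤ psiNeg μ ν r} :=
    isCompact_Icc.of_isClosed_subset (hcont.preimage_isClosed_of_isClosed isClosed_Icc isClosed_Ici)
      fun _ hs => hs.1
  have hmem := hcomp.sInf_mem ⟨r, hr, hru.ge⟩
  exact ⟨hmem.1, le_antisymm ((psiPos_mono ν μ (phi_le μ ν hr hru.ge)).trans hru.le) hmem.2⟩

/-- Ψ₊(u) is 1-Lipschitz in the two quantile functions for the L¹ norm. -/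
theorem tendsto_psiPos {μ ν : Measure ℝ} {μs νs : ℕ → Measure ℝ}
    (hLμ : Tendsto (fun n => ∫⁻ u, ENNReal.ofReal |quantile (μs n) u - quantile μ u| ∂unitLaw)
      atTop (𝓝 0))
    (hLν : Tendsto (fun n => ∫⁻ u, ENNReal.ofReal |quantile (νs n) u - quantile ν u| ∂unitLaw)
      atTop (𝓝 0)) {u : ℝ} (hu : u ≤ 1) :
    Tendsto (fun n => psiPos (μs n) (νs n) u) atTop (𝓝 (psiPos μ ν u)) := by
  have hδ := hLμ.add hLν
  rw [add_zero] at hδ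
  have key : ∀ a b c d : ℝ, ENNReal.ofReal (a - b) ≤
      ENNReal.ofReal (c - d) + (ENNReal.ofReal |a - c| + ENNReal.ofReal |b - d|) := by
    intro a b c d
    rw [← ENNReal.ofReal_add (abs_nonneg _) (abs_nonneg _)]
    refine le_trans (ENNReal.ofReal_le_ofReal ?_) ENNReal.ofReal_add_le
    linarith [le_abs_self (a - c), neg_le_abs (b - d)]
  have key' : ∀ α β γ δ : Measure ℝ, psiPos α β u ≤ psiPos γ δ u +
      (∫⁻ u, ENNReal.ofReal |quantile α u - quantile γ u| ∂unitLaw +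
        ∫⁻ u, ENNReal.ofReal |quantile β u - quantile δ u| ∂unitLaw) := by
    intro α β γ δ
    have m1 := measurable_quantile α
    have m2 := measurable_quantile β
    have m3 := measurable_quantile γ
    have m4 := measurable_quantile δ
    rw [psiPos_eq _ _ hu, psiPos_eq _ _ hu, ← lintegral_add_left (by fun_prop)]
    refine le_trans ?_ (add_le_add_right (setLIntegral_le_lintegral (Iic u) _) _)
    rw [← lintegral_add_left (by fun_prop)]
    exact lintegral_mono fun v => key _ _ _ _
  refine tendsto_of_tendsto_of_tendsto_of_le_of_le
    (g := fun n => psiPos μ ν u -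
      (∫⁻ u, ENNReal.ofReal |quantile (μs n) u - quantile μ u| ∂unitLaw +
        ∫⁻ u, ENNReal.ofReal |quantile (νs n) u - quantile ν u| ∂unitLaw))
    (h := fun n => psiPos μ ν u +
      (∫⁻ u, ENNReal.ofReal |quantile (μs n) u - quantile μ u| ∂unitLaw +
        ∫⁻ u, ENNReal.ofReal |quantile (νs n) u - quantile ν u| ∂unitLaw)) ?_ ?_ ?_ ?_
  · simpa using ENNReal.Tendsto.sub (tendsto_const_nhds (x := psiPos μ ν u)) hδ
      (Or.inr ENNReal.zero_ne_top)
  · simpa using (tendsto_const_nhds (x := psiPos μ ν u)).add hδ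
  · intro n
    simp only [tsub_le_iff_right]
    have := key' μ ν (μs n) (νs n)
    simpa only [abs_sub_comm (quantile μ _), abs_sub_comm (quantile ν _)] using this
  · exact fun n => key' _ _ _ _

/-- Before φ(u), Ψ₋ lies strictly below the level Ψ₊(u) by minimality. After φ(u) it lies strictly
above: were it flat, it would take that level at a rational, which `hq` forbids. Both strict
inequalities survive for large n and trap φ_n(u). -/
theorem tendsto_phi {μ ν : Measure ℝ} {μs νs : ℕ → Measure ℝ} {u : ℝ}
    (hp : Tendsto (fun n => psiPos (μs n) (νs n) u) atTop (𝓝 (psiPos μ ν u)))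
    (hn : ∀ r ≤ 1, Tendsto (fun n => psiNeg (μs n) (νs n) r) atTop (𝓝 (psiNeg μ ν r)))
    (hw : phi μ ν u ∈ Ioo (0 : ℝ) 1) (hweq : psiNeg μ ν (phi μ ν u) = psiPos μ ν u)
    (hq : ∀ q : ℚ, psiPos μ ν u ≠ psiNeg μ ν q) :
    Tendsto (fun n => phi (μs n) (νs n) u) atTop (𝓝 (phi μ ν u)) := by
  have hupper : ∀ r, phi μ ν u < r → r ≤ 1 →
      ∀ᶠ n in atTop, psiPos (μs n) (νs n) u < psiNeg (μs n) (νs n) r := by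
    intro r hr hr1
    obtain ⟨q, hq1, hq2⟩ := exists_rat_btwn hr
    refine hp.eventually_lt (hn r hr1) (lt_of_lt_of_le ?_ (psiPos_mono ν μ hq2.le))
    refine lt_of_le_of_ne ?_ (hq q)
    rw [← hweq]
    exact psiPos_mono ν μ hq1.le
  have hlower : ∀ r, 0 ≤ r → r < phi μ ν u →
      ∀ᶠ n in atTop, psiNeg (μs n) (νs n) r < psiPos (μs n) (νs n) u := by
    intro r hr0 hr
    refine (hn r (hr.le.trans hw.2.le)).eventually_lt hp (lt_of_not_ge fun h => ?_)
    exact absurd (phi_le μ ν ⟨hr0, hr.le.trans hw.2.le⟩ h) (not_le.2 hr)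
  have hbd := exists_between hw.2
  obtain ⟨t, ht, ht1⟩ := hbd
  rw [tendsto_order]
  constructor
  · intro a ha
    obtain ⟨r, hr, hrw⟩ := exists_between (max_lt ha hw.1)
    filter_upwards [hlower r ((le_max_right _ _).trans hr.le) hrw, hupper t ht ht1.le]
      with n h1 h2
    exact ((le_max_left _ _).trans_lt hr).trans_le
      (le_phi _ _ ⟨(hw.1.trans ht).le, ht1.le⟩ h2.le h1)
  · intro b hb
    obtain ⟨r, hr, hrb⟩ := exists_between (lt_min hb hw.2)
    filter_upwards [hupper r hr (hrb.le.trans (min_le_right _ _))] with n h2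
    exact (phi_le _ _ ⟨(hw.1.trans hr).le, hrb.le.trans (min_le_right _ _)⟩ h2.le).trans_lt
      (hrb.trans_le (min_le_left _ _))

theorem ae_tendsto_phi {μ ν : Measure ℝ} [IsProbabilityMeasure μ] [IsProbabilityMeasure ν]
    (hμ : Integrable (fun x : ℝ => x) μ)
    (hν : Integrable (fun x : ℝ => x) ν) (hone : psiPos μ ν 1 = psiNeg μ ν 1)
    {μs νs : ℕ → Measure ℝ}
    (hLμ : Tendsto (fun n => ∫⁻ u, ENNReal.ofReal |quantile (μs n) u - quantile μ u| ∂unitLaw)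
      atTop (𝓝 0))
    (hLν : Tendsto (fun n => ∫⁻ u, ENNReal.ofReal |quantile (νs n) u - quantile ν u| ∂unitLaw)
      atTop (𝓝 0)) :
    ∀ᵐ u ∂unitLaw, quantile ν u < quantile μ u →
      phi μ ν u ∈ Ioo (0 : ℝ) 1 ∧ psiNeg μ ν (phi μ ν u) = psiPos μ ν u ∧
      ContinuousAt (quantile μ) (phi μ ν u) ∧ ContinuousAt (quantile ν) (phi μ ν u) ∧
      Tendsto (fun n => phi (μs n) (νs n) u) atTop (𝓝 (phi μ ν u)) := by
  -- Levels to avoid: the values of Ψ₋ at rationals and at the discontinuities of either quantile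
  -- function. Both are needed because the lemma is also applied with μ and ν exchanged.
  have hC1 := (countable_range fun q : ℚ => psiNeg μ ν q)
  have hC2 := (countable_not_continuousAt_quantile μ).image (psiNeg μ ν)
  have hC3 := (countable_not_continuousAt_quantile ν).image (psiNeg μ ν)
  filter_upwards [ae_unitLaw_mem, ae_psiPos_notMem hμ hν hC1, ae_psiPos_notMem hμ hν hC2,
    ae_psiPos_notMem hμ hν hC3] with u hu h1 h2 h3 hlt
  have hq : ∀ q : ℚ, psiPos μ ν u ≠ psiNeg μ ν q := fun q he => h1 hlt ⟨q, he.symm⟩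
  obtain ⟨hw, hweq⟩ := phi_mem_Icc_and_psiNeg_phi hμ hν (u := u)
    ((psiPos_mono μ ν hu.2.le).trans hone.le)
  have hw' : phi μ ν u ∈ Ioo (0 : ℝ) 1 := by
    refine ⟨lt_of_le_of_ne hw.1 fun h => ?_, lt_of_le_of_ne hw.2 fun h => ?_⟩
    -- The endpoints 0 and 1 are rational, so their levels are already excluded.
    · apply hq 0
      rw [← hweq, ← h, Rat.cast_zero]
    · apply hq 1
      rw [← hweq, h, Rat.cast_one]
  refine ⟨hw', hweq, ?_, ?_, tendsto_phi (tendsto_psiPos hLμ hLν hu.2.le)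
    (fun r hr => tendsto_psiPos hLν hLμ hr) hw' hweq hq⟩
  · by_contra hc
    exact h2 hlt ⟨_, ⟨hw', hc⟩, hweq⟩
  · by_contra hc
    exact h3 hlt ⟨_, ⟨hw', hc⟩, hweq⟩


/-! ### Couplings driven by a uniform random variable -/

theorem leftLim_cdf_le_of_quantile_eq (μ : Measure ℝ) {u t : ℝ} (hu : u ∈ Ioo (0 : ℝ) 1)
    (h : quantile μ u = t) : Function.leftLim (cdf μ) t ≤ u := by
  refine le_of_tendsto ((monotone_cdf μ).tendsto_leftLim t) ?_
  filter_upwards [self_mem_nhdsWithin] with s hs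
  exact ((lt_quantile_iff μ hu s).1 (h ▸ hs)).le

theorem quantile_eq_of_mem_Ioc (μ : Measure ℝ) {u t : ℝ} (hu : u ∈ Ioo (0 : ℝ) 1)
    (h : u ∈ Ioc (Function.leftLim (cdf μ) t) (cdf μ t)) : quantile μ u = t := by
  refine le_antisymm ((quantile_le_iff μ hu t).2 h.2) (le_of_not_gt fun hlt => ?_)
  have h1 := (quantile_le_iff μ hu _).1 le_rfl
  exact absurd (h1.trans ((monotone_cdf μ).le_leftLim hlt)) (not_le.2 h.1)

theorem measure_singleton_eq_cdf_sub_leftLim (μ : Measure ℝ) [IsProbabilityMeasure μ] (t : ℝ) :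
    μ {t} = ENNReal.ofReal (cdf μ t - Function.leftLim (cdf μ) t) := by
  conv_lhs => rw [← measure_cdf μ]
  exact StieltjesFunction.measure_singleton _ _

theorem leftLim_cdf_nonneg (μ : Measure ℝ) (t : ℝ) : 0 ≤ Function.leftLim (cdf μ) t :=
  (cdf_nonneg μ (t - 1)).trans ((monotone_cdf μ).le_leftLim (by linarith))

theorem unitLaw_restrict_quantile_preimage (μ : Measure ℝ) (t : ℝ) :
    unitLaw.restrict (quantile μ ⁻¹' {t}) =
      volume.restrict (Ioc (Function.leftLim (cdf μ) t) (cdf μ t)) := by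
  rw [unitLaw, Measure.restrict_restrict (measurable_quantile μ (measurableSet_singleton t))]
  refine Measure.restrict_congr_set ?_
  -- The two sets can differ only at u = 1 and at u = F(t-).
  filter_upwards [compl_mem_ae_iff.2 (measure_singleton (μ := volume) (1 : ℝ)),
    compl_mem_ae_iff.2 (measure_singleton (μ := volume) (Function.leftLim (cdf μ) t))]
    with u h1 h2
  refine propext ⟨fun hu => ?_, fun hu => ?_⟩
  · have hut : quantile μ u = t := hu.1
    exact ⟨lt_of_le_of_ne (leftLim_cdf_le_of_quantile_eq μ hu.2 hut) (Ne.symm h2),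
      (quantile_le_iff μ hu.2 t).1 hut.le⟩
  · have hu' : u ∈ Ioo (0 : ℝ) 1 := ⟨(leftLim_cdf_nonneg μ t).trans_lt hu.1,
      lt_of_le_of_ne (hu.2.trans (cdf_le_one μ t)) h1⟩
    exact ⟨quantile_eq_of_mem_Ioc μ hu' hu, hu'⟩

/-- Away from atoms, F is continuous at F⁻¹(u), which forces F(F⁻¹(u)) = u. -/
theorem mOfTildeFun_quantile (μ : Measure ℝ) [IsProbabilityMeasure μ] (κ : Kernel ℝ ℝ) {u : ℝ}
    (hu : u ∈ Ioo (0 : ℝ) 1) (h : μ {quantile μ u} = 0) :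
    mOfTildeFun μ κ (quantile μ u) = κ u := by
  have hle := leftLim_cdf_le_of_quantile_eq μ hu rfl
  have hge := (quantile_le_iff μ hu _).1 le_rfl
  have heq : cdf μ (quantile μ u) ≤ Function.leftLim (cdf μ) (quantile μ u) := by
    rw [measure_singleton_eq_cdf_sub_leftLim, ENNReal.ofReal_eq_zero] at h
    linarith
  have hF : cdf μ (quantile μ u) = u := le_antisymm (heq.trans hle) hge
  have hL : Function.leftLim (cdf μ) (quantile μ u) = u := le_antisymm hle (hge.trans heq)
  rw [mOfTildeFun, hF, hL, if_neg (by rintro (h0 | h0) <;> linarith [hu.1, hu.2]),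
    if_neg (by simp [h])]

/-- At an atom t the quantile equals t on (F(t-), F(t)] up to a null set. The kernel m(t, ·) is the
average of m̃ over this interval, and the length μ({t}) cancels the normalisation. -/
theorem setLIntegral_mOfTildeFun_quantile_singleton (μ : Measure ℝ) [IsProbabilityMeasure μ]
    (κ : Kernel ℝ ℝ) {t : ℝ} (ht : 0 < μ {t}) {B : Set ℝ} (hB : MeasurableSet B) :
    ∫⁻ u in quantile μ ⁻¹' {t}, mOfTildeFun μ κ (quantile μ u) B ∂unitLaw =
      ∫⁻ u in quantile μ ⁻¹' {t}, κ u B ∂unitLaw := by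
  have hm := measurable_quantile μ (measurableSet_singleton t)
  rw [setLIntegral_congr_fun (g := fun _ => mOfTildeFun μ κ t B) hm
    fun u hu => by rw [show quantile μ u = t from hu], setLIntegral_const,
    ← Measure.map_apply (measurable_quantile μ) (measurableSet_singleton t),
    map_quantile_unitLaw, unitLaw_restrict_quantile_preimage]
  have hlt : Function.leftLim (cdf μ) t < cdf μ t := by
    rw [measure_singleton_eq_cdf_sub_leftLim, ENNReal.ofReal_pos] at ht
    linarith
  have h1 : ¬ (cdf μ t = 0 ∨ Function.leftLim (cdf μ) t = 1) := by
    rintro (h0 | h0)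
    · linarith [leftLim_cdf_nonneg μ t]
    · linarith [cdf_le_one μ t]
  rw [mOfTildeFun, if_neg h1, if_pos ht, Measure.smul_apply, smul_eq_mul,
    Measure.bind_apply hB κ.measurable.aemeasurable, mul_comm, ← mul_assoc,
    ENNReal.mul_inv_cancel ht.ne' (measure_ne_top μ _), one_mul]

theorem setLIntegral_mOfTildeFun_quantile (μ : Measure ℝ) [IsProbabilityMeasure μ]
    (κ : Kernel ℝ ℝ) {A B : Set ℝ} (hA : MeasurableSet A) (hB : MeasurableSet B) :
    ∫⁻ u in quantile μ ⁻¹' A, mOfTildeFun μ κ (quantile μ u) B ∂unitLaw =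
      ∫⁻ u in quantile μ ⁻¹' A, κ u B ∂unitLaw := by
  have hQ := measurable_quantile μ
  set T : Set ℝ := {t | 0 < μ {t}}
  have hT : T.Countable := Measure.countable_meas_level_set_pos (μ := μ) (g := fun x : ℝ => x)
    measurable_id
  have hunion : quantile μ ⁻¹' A ∩ quantile μ ⁻¹' T =
      ⋃ t ∈ A ∩ T, quantile μ ⁻¹' {t} := by
    ext u
    simp
  -- Atoms are countable: the integrals agree atom by atom on their preimage, and the integrands
  -- agree almost everywhere off it.
  rw [← lintegral_inter_add_sdiff _ (quantile μ ⁻¹' A) (hQ hT.measurableSet),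
    ← lintegral_inter_add_sdiff (fun u => κ u B) (quantile μ ⁻¹' A) (hQ hT.measurableSet), hunion]
  have hd : (A ∩ T).PairwiseDisjoint fun t => quantile μ ⁻¹' {t} := fun s _ t _ hst =>
    Disjoint.preimage _ (disjoint_singleton.2 hst)
  have hc : (A ∩ T).Countable := hT.mono inter_subset_right
  rw [lintegral_biUnion hc (fun t _ => hQ (measurableSet_singleton t)) hd,
    lintegral_biUnion hc (fun t _ => hQ (measurableSet_singleton t)) hd]
  congr 1
  · exact tsum_congr fun t => setLIntegral_mOfTildeFun_quantile_singleton μ κ t.2.2 hB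
  · refine setLIntegral_congr_fun_ae ((hQ hA).diff (hQ hT.measurableSet)) ?_
    filter_upwards [ae_unitLaw_mem] with u hu huA
    rw [mOfTildeFun_quantile μ κ hu]
    simpa [T] using huA.2

/-- Drawing `x` from `μ` and `y` from `m(x, dy)` amounts to drawing `u` uniformly, `y` from
`m̃(u, dy)` and taking `x` to be the quantile of `μ` at level `u`. -/
theorem compProd_mOfTilde_apply_prod (μ : Measure ℝ) [IsProbabilityMeasure μ] (κ : Kernel ℝ ℝ)
    [IsMarkovKernel κ] {A B : Set ℝ} (hA : MeasurableSet A) (hB : MeasurableSet B) :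
    (μ ⊗ₘ mOfTilde μ κ) (A ×ˢ B) = ∫⁻ u in quantile μ ⁻¹' A, κ u B ∂unitLaw := by
  rw [Measure.compProd_apply_prod hA hB, ← setLIntegral_mOfTildeFun_quantile μ κ hA hB]
  have h := setLIntegral_map (μ := unitLaw) hA (Kernel.measurable_coe (mOfTilde μ κ) hB)
    (measurable_quantile μ)
  rwa [map_quantile_unitLaw] at h

/-! ### Two-point form of the kernel and its realisation by uniform variables. -/

open Classical in
/-- The weight of the first point of the measure `m̃(u, dy)`. -/
noncomputable def jumpProb (μ ν : Measure ℝ) (u : ℝ) : ℝ :=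
  if quantile ν u < quantile μ u ∧ quantile μ u < quantile ν (phi μ ν u) ∧ phi μ ν u < 1 then
    (quantile μ u - quantile ν u) / (quantile ν (phi μ ν u) - quantile ν u)
  else if quantile ν (phiTilde μ ν u) < quantile μ u ∧ quantile μ u < quantile ν u ∧
      phiTilde μ ν u < 1 then
    (quantile ν u - quantile μ u) / (quantile ν u - quantile ν (phiTilde μ ν u))
  else 0

open Classical in
/-- The first point of the measure `m̃(u, dy)`; the second one is the quantile of `ν` at `u`. -/
noncomputable def jumpTarget (μ ν : Measure ℝ) (u : ℝ) : ℝ :=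
  if quantile ν u < quantile μ u ∧ quantile μ u < quantile ν (phi μ ν u) ∧ phi μ ν u < 1 then
    quantile ν (phi μ ν u)
  else if quantile ν (phiTilde μ ν u) < quantile μ u ∧ quantile μ u < quantile ν u ∧
      phiTilde μ ν u < 1 then
    quantile ν (phiTilde μ ν u)
  else quantile ν u

theorem mTildeFun_eq_twoPoint (μ ν : Measure ℝ) (u : ℝ) :
    mTildeFun μ ν u = twoPoint (jumpProb μ ν u) (jumpTarget μ ν u) (quantile ν u) := by
  unfold mTildeFun jumpProb jumpTarget
  split_ifs
  · rfl
  · rfl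
  · simp [twoPoint]

theorem jump_of_lt {μ ν : Measure ℝ} {u : ℝ} (h : quantile ν u < quantile μ u ∧
    quantile μ u < quantile ν (phi μ ν u) ∧ phi μ ν u < 1) :
    jumpProb μ ν u = (quantile μ u - quantile ν u) / (quantile ν (phi μ ν u) - quantile ν u) ∧
      jumpTarget μ ν u = quantile ν (phi μ ν u) :=
  ⟨if_pos h, if_pos h⟩

theorem jump_of_gt {μ ν : Measure ℝ} {u : ℝ} (h : quantile ν (phiTilde μ ν u) < quantile μ u ∧
    quantile μ u < quantile ν u ∧ phiTilde μ ν u < 1) :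
    jumpProb μ ν u =
        (quantile ν u - quantile μ u) / (quantile ν u - quantile ν (phiTilde μ ν u)) ∧
      jumpTarget μ ν u = quantile ν (phiTilde μ ν u) := by
  have h' : ¬ (quantile ν u < quantile μ u ∧
      quantile μ u < quantile ν (phi μ ν u) ∧ phi μ ν u < 1) := fun h' => h.2.1.not_gt h'.1
  exact ⟨(if_neg h').trans (if_pos h), (if_neg h').trans (if_pos h)⟩

theorem measurable_jumpProb (μ ν : Measure ℝ) : Measurable (jumpProb μ ν) := by
  have hμ := measurable_quantile μ
  have hν := measurable_quantile ν
  have hφ := measurable_phi μ ν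
  have hψ := measurable_phiTilde μ ν
  have hνφ : Measurable fun u => quantile ν (phi μ ν u) := hν.comp hφ
  have hνψ : Measurable fun u => quantile ν (phiTilde μ ν u) := hν.comp hψ
  refine Measurable.ite ?_ ((hμ.sub hν).div (hνφ.sub hν))
    (Measurable.ite ?_ ((hν.sub hμ).div (hν.sub hνψ)) measurable_const)
  · exact (measurableSet_lt hν hμ).inter
      ((measurableSet_lt hμ hνφ).inter (measurableSet_lt hφ measurable_const))
  · exact (measurableSet_lt hνψ hμ).inter
      ((measurableSet_lt hμ hν).inter (measurableSet_lt hψ measurable_const))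

theorem measurable_jumpTarget (μ ν : Measure ℝ) : Measurable (jumpTarget μ ν) := by
  have hμ := measurable_quantile μ
  have hν := measurable_quantile ν
  have hφ := measurable_phi μ ν
  have hψ := measurable_phiTilde μ ν
  have hνφ : Measurable fun u => quantile ν (phi μ ν u) := hν.comp hφ
  have hνψ : Measurable fun u => quantile ν (phiTilde μ ν u) := hν.comp hψ
  refine Measurable.ite ?_ hνφ (Measurable.ite ?_ hνψ hν)
  · exact (measurableSet_lt hν hμ).inter
      ((measurableSet_lt hμ hνφ).inter (measurableSet_lt hφ measurable_const))
  · exact (measurableSet_lt hνψ hμ).inter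
      ((measurableSet_lt hμ hν).inter (measurableSet_lt hψ measurable_const))

theorem jumpProb_mem_Icc (μ ν : Measure ℝ) (u : ℝ) : jumpProb μ ν u ∈ Icc (0 : ℝ) 1 := by
  unfold jumpProb
  split_ifs with h1 h2
  · have h3 : 0 < quantile ν (phi μ ν u) - quantile ν u := by linarith [h1.1, h1.2.1]
    exact ⟨div_nonneg (by linarith [h1.1]) h3.le, (div_le_one h3).2 (by linarith [h1.2.1])⟩
  · have h3 : 0 < quantile ν u - quantile ν (phiTilde μ ν u) := by linarith [h2.1, h2.2.1]
    exact ⟨div_nonneg (by linarith [h2.2.1]) h3.le, (div_le_one h3).2 (by linarith [h2.1])⟩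
  · exact ⟨le_rfl, zero_le_one⟩

/-- The denominator of the weight is the length of the jump, so the mean displacement is exactly the
gap between the quantiles when there is a jump, and 0 otherwise. All domination rests on this. -/
theorem jumpProb_mul_abs_le (μ ν : Measure ℝ) (u : ℝ) :
    jumpProb μ ν u * |jumpTarget μ ν u - quantile ν u| ≤ |quantile μ u - quantile ν u| := by
  unfold jumpProb jumpTarget
  split_ifs with h1 h2
  · have h3 : 0 < quantile ν (phi μ ν u) - quantile ν u := by linarith [h1.1, h1.2.1]
    rw [abs_of_pos h3, div_mul_cancel₀ _ h3.ne']
    exact le_abs_self _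
  · have h3 : 0 < quantile ν u - quantile ν (phiTilde μ ν u) := by linarith [h2.1, h2.2.1]
    rw [abs_sub_comm, abs_of_pos h3, div_mul_cancel₀ _ h3.ne', abs_sub_comm]
    exact le_abs_self _
  · simp

/-- A variable with law `p δ_x + (1 - p) δ_y` as a function of a uniform variable `v`. -/
noncomputable def pick (p x y v : ℝ) : ℝ :=
  if v ≤ p then x else y

theorem measurable_pick {α : Type*} [MeasurableSpace α] {p x y v : α → ℝ} (hp : Measurable p)
    (hx : Measurable x) (hy : Measurable y) (hv : Measurable v) :
    Measurable fun a => pick (p a) (x a) (y a) (v a) :=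
  Measurable.ite (measurableSet_le hv hp) hx hy

theorem unitLaw_pick_preimage {p : ℝ} (hp : p ∈ Icc (0 : ℝ) 1) (x y : ℝ) {B : Set ℝ}
    (hB : MeasurableSet B) : unitLaw (pick p x y ⁻¹' B) = twoPoint p x y B := by
  have hpre : pick p x y ⁻¹' B =
      (Iic p ∩ {_v | x ∈ B}) ∪ (Ioi p ∩ {_v | y ∈ B}) := by
    ext v
    by_cases hv : v ≤ p
    · simp [pick, hv]
    · simp [pick, hv, not_le.1 hv]
  have hdisj : Disjoint (Iic p ∩ {_v | x ∈ B}) (Ioi p ∩ {_v | y ∈ B}) :=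
    (Iic_disjoint_Ioi le_rfl).mono inter_subset_left inter_subset_left
  rw [hpre, measure_union hdisj (measurableSet_Ioi.inter (MeasurableSet.const _))]
  simp only [twoPoint, Measure.coe_add, Measure.coe_smul, Pi.add_apply, Pi.smul_apply, smul_eq_mul,
    Measure.dirac_apply' _ hB]
  congr 1
  · by_cases hx : x ∈ B <;> simp [hx, unitLaw_Iic hp.2]
  · by_cases hy : y ∈ B <;> simp [hy, unitLaw_Ioi hp.1]

/-- A pair with law the inverse transform martingale coupling, as a function of two independent
uniform variables. -/
noncomputable def uniformPair (μ ν : Measure ℝ) (z : ℝ × ℝ) : ℝ × ℝ :=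
  (quantile μ z.1, pick (jumpProb μ ν z.1) (jumpTarget μ ν z.1) (quantile ν z.1) z.2)

theorem measurable_uniformPair (μ ν : Measure ℝ) : Measurable (uniformPair μ ν) :=
  ((measurable_quantile μ).comp measurable_fst).prodMk
    (measurable_pick ((measurable_jumpProb μ ν).comp measurable_fst)
      ((measurable_jumpTarget μ ν).comp measurable_fst)
      ((measurable_quantile ν).comp measurable_fst) measurable_snd)

theorem map_uniformPair (μ ν : Measure ℝ) [IsProbabilityMeasure μ] :
    (unitLaw.prod unitLaw).map (uniformPair μ ν) = inverseTransformCoupling μ ν := by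
  have hm := measurable_uniformPair μ ν
  have : IsFiniteMeasure (inverseTransformCoupling μ ν) := by
    unfold inverseTransformCoupling
    infer_instance
  refine Measure.ext_prod fun {A B} hA hB => ?_
  rw [inverseTransformCoupling, compProd_mOfTilde_apply_prod μ _ hA hB,
    Measure.map_apply hm (hA.prod hB), Measure.prod_apply (hm (hA.prod hB)),
    ← lintegral_indicator (measurable_quantile μ hA)]
  refine lintegral_congr fun u => ?_
  by_cases hu : quantile μ u ∈ A
  · rw [indicator_of_mem (mem_preimage.2 hu)]
    change _ = mTildeFun μ ν u B
    rw [mTildeFun_eq_twoPoint, ← unitLaw_pick_preimage (jumpProb_mem_Icc μ ν u) _ _ hB]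
    congr 1
    ext v
    simp [uniformPair, hu]
  · rw [indicator_of_notMem (by exact hu)]
    convert measure_empty (μ := unitLaw)
    ext v
    simp [uniformPair, hu]


/-! ### Stability -/

theorem lintegral_abs_pick_sub {p : ℝ} (hp : p ∈ Icc (0 : ℝ) 1) (x y : ℝ) :
    ∫⁻ v, ENNReal.ofReal |pick p x y v - y| ∂unitLaw = ENNReal.ofReal (p * |x - y|) := by
  have : (fun v => ENNReal.ofReal |pick p x y v - y|) =
      (Iic p).indicator fun _ => ENNReal.ofReal |x - y| := by
    funext v
    by_cases hv : v ≤ p <;> simp [pick, hv]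
  rw [this, lintegral_indicator_const measurableSet_Iic, unitLaw_Iic hp.2,
    ← ENNReal.ofReal_mul (abs_nonneg _), mul_comm]

theorem abs_pick_le (p x y v : ℝ) : |pick p x y v| ≤ |x| + |y| := by
  unfold pick
  split_ifs
  · linarith [abs_nonneg y]
  · linarith [abs_nonneg x]

/-- For v ≠ p the choice made at `ps n` is eventually the one made at p; bounded convergence
concludes. -/
theorem tendsto_lintegral_abs_pick_sub {ps xs ys : ℕ → ℝ} {p x y : ℝ}
    (hp : Tendsto ps atTop (𝓝 p)) (hx : Tendsto xs atTop (𝓝 x)) (hy : Tendsto ys atTop (𝓝 y)) :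
    Tendsto (fun n => ∫⁻ v, ENNReal.ofReal |pick (ps n) (xs n) (ys n) v - pick p x y v| ∂unitLaw)
      atTop (𝓝 0) := by
  have hm : ∀ p x y : ℝ, Measurable (pick p x y) := fun p x y =>
    measurable_pick measurable_const measurable_const measurable_const measurable_id
  have h0 : ∫⁻ _, 0 ∂unitLaw = 0 := lintegral_zero
  rw [← h0]
  refine tendsto_lintegral_filter_of_dominated_convergence
    (fun _ => ENNReal.ofReal (2 * (|x| + |y|) + 1))
    (Eventually.of_forall fun n => ((hm _ _ _).sub (hm _ _ _)).abs.ennreal_ofReal) ?_ ?_ ?_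
  · have hb : ∀ᶠ n in atTop, |xs n| + |ys n| < |x| + |y| + 1 :=
      (hx.abs.add hy.abs).eventually (eventually_lt_nhds (by linarith))
    filter_upwards [hb] with n hn
    refine ae_of_all _ fun v => ENNReal.ofReal_le_ofReal ((abs_sub _ _).trans ?_)
    linarith [abs_pick_le (ps n) (xs n) (ys n) v, abs_pick_le p x y v]
  · simp
  · have hne : ∀ᵐ v ∂unitLaw, v ≠ p :=
      Eventually.filter_mono (ae_mono Measure.restrict_le_self)
        (compl_mem_ae_iff.2 (measure_singleton (μ := volume) p))
    filter_upwards [hne] with v hv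
    have key : Tendsto (fun n => pick (ps n) (xs n) (ys n) v) atTop (𝓝 (pick p x y v)) := by
      rcases lt_or_gt_of_ne hv with h | h
      · rw [pick, if_pos h.le]
        refine hx.congr' ?_
        filter_upwards [hp.eventually (eventually_gt_nhds h)] with n hn
        rw [pick, if_pos hn.le]
      · rw [pick, if_neg h.not_ge]
        refine hy.congr' ?_
        filter_upwards [hp.eventually (eventually_lt_nhds h)] with n hn
        rw [pick, if_neg hn.not_ge]
    have h1 := (key.sub_const (pick p x y v)).abs
    rw [sub_self, abs_zero] at h1
    simpa using ENNReal.tendsto_ofReal h1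

/-- The distance between the second coordinates of two uniform pairs, averaged over the second
uniform variable. -/
noncomputable def pairCost (μ ν μ' ν' : Measure ℝ) (u : ℝ) : ℝ≥0∞ :=
  ∫⁻ v, ENNReal.ofReal |(uniformPair μ ν (u, v)).2 - (uniformPair μ' ν' (u, v)).2| ∂unitLaw

theorem tendsto_pairCost {μ ν : Measure ℝ} {μs νs : ℕ → Measure ℝ} {u : ℝ}
    (hp : Tendsto (fun n => jumpProb (μs n) (νs n) u) atTop (𝓝 (jumpProb μ ν u)))
    (hx : Tendsto (fun n => jumpTarget (μs n) (νs n) u) atTop (𝓝 (jumpTarget μ ν u)))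
    (hy : Tendsto (fun n => quantile (νs n) u) atTop (𝓝 (quantile ν u))) :
    Tendsto (fun n => pairCost (μs n) (νs n) μ ν u) atTop (𝓝 0) := by
  simp only [pairCost, uniformPair]
  exact tendsto_lintegral_abs_pick_sub hp hx hy

theorem lintegral_abs_uniformPair_sub_le (μ ν : Measure ℝ) (u : ℝ) :
    ∫⁻ v, ENNReal.ofReal |(uniformPair μ ν (u, v)).2 - quantile ν u| ∂unitLaw ≤
      ENNReal.ofReal |quantile μ u - quantile ν u| :=
  (lintegral_abs_pick_sub (jumpProb_mem_Icc μ ν u) _ _).trans_le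
    (ENNReal.ofReal_le_ofReal (jumpProb_mul_abs_le μ ν u))

/-- Triangle inequality through F_ν⁻¹(u) and F_ν'⁻¹(u). -/
theorem pairCost_le (μ ν μ' ν' : Measure ℝ) (u : ℝ) :
    pairCost μ ν μ' ν' u ≤ ENNReal.ofReal |quantile μ u - quantile ν u| +
      ENNReal.ofReal |quantile ν u - quantile ν' u| +
      ENNReal.ofReal |quantile μ' u - quantile ν' u| := by
  have hm : ∀ α β : Measure ℝ, Measurable fun v =>
      ENNReal.ofReal |(uniformPair α β (u, v)).2 - quantile β u| := fun α β =>
    (((measurable_uniformPair α β).snd.comp measurable_prodMk_left).sub_const _).abs.ennreal_ofReal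
  calc pairCost μ ν μ' ν' u
      ≤ ∫⁻ v, (ENNReal.ofReal |(uniformPair μ ν (u, v)).2 - quantile ν u| +
          ENNReal.ofReal |quantile ν u - quantile ν' u| +
          ENNReal.ofReal |(uniformPair μ' ν' (u, v)).2 - quantile ν' u|) ∂unitLaw := by
        refine lintegral_mono fun v => ?_
        rw [← ENNReal.ofReal_add (abs_nonneg _) (abs_nonneg _),
          ← ENNReal.ofReal_add (by positivity) (abs_nonneg _)]
        refine ENNReal.ofReal_le_ofReal ?_
        rw [abs_sub_comm ((uniformPair μ' ν' (u, v)).2)]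
        refine (abs_sub_le _ (quantile ν' u) _).trans (add_le_add_left ?_ _)
        exact abs_sub_le _ _ _
    _ ≤ _ := by
        rw [lintegral_add_right _ (hm μ' ν'), lintegral_add_right _ measurable_const,
          lintegral_const, measure_univ, mul_one]
        gcongr
        · exact lintegral_abs_uniformPair_sub_le μ ν u
        · exact lintegral_abs_uniformPair_sub_le μ' ν' u

/-- Dominated convergence applies to min(g, b), and the excess of g over b is at most δ, whose
integral vanishes in the limit. -/
theorem tendsto_lintegral_of_le_add {α : Type*} [MeasurableSpace α] {m : Measure α}
    {g δ : ℕ → α → ℝ≥0∞} {b : α → ℝ≥0∞} (hg : ∀ n, Measurable (g n)) (hb : Measurable b)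
    (hle : ∀ n x, g n x ≤ b x + δ n x) (hbfin : ∫⁻ x, b x ∂m ≠ ∞)
    (hδ : Tendsto (fun n => ∫⁻ x, δ n x ∂m) atTop (𝓝 0))
    (hlim : ∀ᵐ x ∂m, Tendsto (fun n => g n x) atTop (𝓝 0)) :
    Tendsto (fun n => ∫⁻ x, g n x ∂m) atTop (𝓝 0) := by
  have h1 : Tendsto (fun n => ∫⁻ x, min (g n x) (b x) ∂m) atTop (𝓝 (∫⁻ _, 0 ∂m)) := by
    refine tendsto_lintegral_of_dominated_convergence b (fun n => (hg n).min hb)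
      (fun n => ae_of_all _ fun x => min_le_right _ _) hbfin ?_
    filter_upwards [hlim] with x hx
    exact tendsto_of_tendsto_of_tendsto_of_le_of_le tendsto_const_nhds hx
      (fun _ => zero_le) fun n => min_le_left _ _
  have h2 := h1.add hδ
  rw [lintegral_zero, add_zero] at h2
  refine tendsto_of_tendsto_of_tendsto_of_le_of_le tendsto_const_nhds h2 (fun _ => zero_le)
    fun n => ?_
  rw [← lintegral_add_left ((hg n).min hb)]
  refine lintegral_mono fun x => ?_
  rcases le_total (g n x) (b x) with h | h
  · simp only [min_eq_left h]
    exact le_self_add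
  · simp only [min_eq_right h]
    exact hle n x

/-! ### Almost everywhere and mean convergence of the cost. -/

section

variable {μ ν : Measure ℝ} [IsProbabilityMeasure μ] [IsProbabilityMeasure ν]
  {μs νs : ℕ → Measure ℝ}

theorem ae_tendsto_quantile {η : Measure ℝ} {ηs : ℕ → Measure ℝ}
    (hL : Tendsto (fun n => ∫⁻ u, ENNReal.ofReal |quantile (ηs n) u - quantile η u| ∂unitLaw)
      atTop (𝓝 0)) :
    ∀ᵐ u ∂unitLaw, Tendsto (fun n => quantile (ηs n) u) atTop (𝓝 (quantile η u)) := by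
  filter_upwards [ae_unitLaw_mem, ae_continuousAt_quantile η] with u hu hc
  exact tendsto_of_monotoneOn_of_lintegral_tendsto (fun n => monotoneOn_quantile (ηs n)) hL hu hc
    tendsto_const_nhds

theorem ae_tendsto_pairCost_of_lt (hμ : Integrable (fun x : ℝ => x) μ)
    (hν : Integrable (fun x : ℝ => x) ν) (hcx : ConvexOrderLE μ ν)
    (hLμ : Tendsto (fun n => ∫⁻ u, ENNReal.ofReal |quantile (μs n) u - quantile μ u| ∂unitLaw)
      atTop (𝓝 0))
    (hLν : Tendsto (fun n => ∫⁻ u, ENNReal.ofReal |quantile (νs n) u - quantile ν u| ∂unitLaw)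
      atTop (𝓝 0)) :
    ∀ᵐ u ∂unitLaw, quantile ν u < quantile μ u →
      Tendsto (fun n => pairCost (μs n) (νs n) μ ν u) atTop (𝓝 0) := by
  filter_upwards [ae_unitLaw_mem, ae_mem_gapSet μ ν, ae_tendsto_quantile hLμ,
    ae_tendsto_quantile hLν,
    ae_tendsto_phi hμ hν (hcx.psiNeg_one hμ hν).symm hLμ hLν] with u hu hgap hqμ hqν hphi hlt
  obtain ⟨hw, hweq, -, hcν, hlim⟩ := hphi hlt
  -- Ψ₋(u) < Ψ₊(u) = Ψ₋(φ(u)), so Ψ₋ grows between u and φ(u), and the quantiles are in reverse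
  -- order at some v there.
  have hψ := hcx.psiNeg_lt_psiPos hμ hν (Or.inl (hgap hlt))
  rw [← hweq] at hψ
  obtain ⟨huw, v, hv, hvlt⟩ := exists_quantile_lt_of_psiPos_lt hu.1.le hψ
  have hv01 : v ∈ Ioo (0 : ℝ) 1 := ⟨hu.1.trans hv.1, hv.2.trans_lt hw.2⟩
  have hlt' : quantile μ u < quantile ν (phi μ ν u) :=
    ((monotoneOn_quantile μ hu hv01 hv.1.le).trans_lt hvlt).trans_le
      (monotoneOn_quantile ν hv01 hw hv.2)
  have hqφ := tendsto_of_monotoneOn_of_lintegral_tendsto (fun n => monotoneOn_quantile (νs n))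
    hLν hw hcν hlim
  -- The limiting inequalities are strict, so for large n the approximating kernel is in the same
  -- branch.
  have hev : ∀ᶠ n in atTop, quantile (νs n) u < quantile (μs n) u ∧
      quantile (μs n) u < quantile (νs n) (phi (μs n) (νs n) u) ∧ phi (μs n) (νs n) u < 1 :=
    (hqν.eventually_lt hqμ hlt).and ((hqμ.eventually_lt hqφ hlt').and
      (hlim.eventually (eventually_lt_nhds hw.2)))
  have hcond : quantile ν u < quantile μ u ∧
      quantile μ u < quantile ν (phi μ ν u) ∧ phi μ ν u < 1 := ⟨hlt, hlt', hw.2⟩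
  refine tendsto_pairCost ?_ ?_ hqν
  · rw [(jump_of_lt hcond).1]
    refine Tendsto.congr' ?_ ((hqμ.sub hqν).div (hqφ.sub hqν) (sub_pos.2 (hlt.trans hlt')).ne')
    filter_upwards [hev] with n hn using (jump_of_lt hn).1.symm
  · rw [(jump_of_lt hcond).2]
    refine Tendsto.congr' ?_ hqφ
    filter_upwards [hev] with n hn using (jump_of_lt hn).2.symm

theorem ae_tendsto_pairCost_of_gt (hμ : Integrable (fun x : ℝ => x) μ)
    (hν : Integrable (fun x : ℝ => x) ν) (hcx : ConvexOrderLE μ ν)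
    (hLμ : Tendsto (fun n => ∫⁻ u, ENNReal.ofReal |quantile (μs n) u - quantile μ u| ∂unitLaw)
      atTop (𝓝 0))
    (hLν : Tendsto (fun n => ∫⁻ u, ENNReal.ofReal |quantile (νs n) u - quantile ν u| ∂unitLaw)
      atTop (𝓝 0)) :
    ∀ᵐ u ∂unitLaw, quantile μ u < quantile ν u →
      Tendsto (fun n => pairCost (μs n) (νs n) μ ν u) atTop (𝓝 0) := by
  filter_upwards [ae_unitLaw_mem, ae_mem_gapSet ν μ, ae_tendsto_quantile hLμ,
    ae_tendsto_quantile hLν,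
    ae_tendsto_phi hν hμ (hcx.psiNeg_one hμ hν) hLν hLμ] with u hu hgap hqμ hqν hphi hlt
  obtain ⟨hw, hweq, hcν, -, hlim⟩ := hphi hlt
  -- Now Ψ₊(φ̃(u)) = Ψ₋(u) < Ψ₊(u): the target lies on the left, and v is found in (φ̃(u), u].
  have hψ : psiPos μ ν (phi ν μ u) < psiPos μ ν u :=
    lt_of_eq_of_lt hweq (hcx.psiNeg_lt_psiPos hμ hν (Or.inr (hgap hlt)))
  obtain ⟨huw, v, hv, hvlt⟩ := exists_quantile_lt_of_psiPos_lt hw.1.le hψ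
  have hv01 : v ∈ Ioo (0 : ℝ) 1 := ⟨hw.1.trans hv.1, hv.2.trans_lt hu.2⟩
  have hlt' : quantile ν (phiTilde μ ν u) < quantile μ u :=
    ((monotoneOn_quantile ν hw hv01 hv.1.le).trans_lt hvlt).trans_le
      (monotoneOn_quantile μ hv01 hu hv.2)
  have hqφ : Tendsto (fun n => quantile (νs n) (phiTilde (μs n) (νs n) u)) atTop
      (𝓝 (quantile ν (phiTilde μ ν u))) :=
    tendsto_of_monotoneOn_of_lintegral_tendsto (fun n => monotoneOn_quantile (νs n))
      hLν hw hcν hlim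
  have hev : ∀ᶠ n in atTop, quantile (νs n) (phiTilde (μs n) (νs n) u) < quantile (μs n) u ∧
      quantile (μs n) u < quantile (νs n) u ∧ phiTilde (μs n) (νs n) u < 1 :=
    (hqφ.eventually_lt hqμ hlt').and ((hqμ.eventually_lt hqν hlt).and
      (hlim.eventually (eventually_lt_nhds hw.2)))
  have hcond : quantile ν (phiTilde μ ν u) < quantile μ u ∧
      quantile μ u < quantile ν u ∧ phiTilde μ ν u < 1 := ⟨hlt', hlt, hw.2⟩
  refine tendsto_pairCost ?_ ?_ hqν
  · rw [(jump_of_gt hcond).1]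
    refine Tendsto.congr' ?_ ((hqν.sub hqμ).div (hqν.sub hqφ) (sub_pos.2 (hlt'.trans hlt)).ne')
    filter_upwards [hev] with n hn using (jump_of_gt hn).1.symm
  · rw [(jump_of_gt hcond).2]
    refine Tendsto.congr' ?_ hqφ
    filter_upwards [hev] with n hn using (jump_of_gt hn).2.symm

theorem ae_tendsto_pairCost (hμ : Integrable (fun x : ℝ => x) μ)
    (hν : Integrable (fun x : ℝ => x) ν) (hcx : ConvexOrderLE μ ν)
    (hLμ : Tendsto (fun n => ∫⁻ u, ENNReal.ofReal |quantile (μs n) u - quantile μ u| ∂unitLaw)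
      atTop (𝓝 0))
    (hLν : Tendsto (fun n => ∫⁻ u, ENNReal.ofReal |quantile (νs n) u - quantile ν u| ∂unitLaw)
      atTop (𝓝 0)) :
    ∀ᵐ u ∂unitLaw, Tendsto (fun n => pairCost (μs n) (νs n) μ ν u) atTop (𝓝 0) := by
  filter_upwards [ae_tendsto_pairCost_of_lt hμ hν hcx hLμ hLν,
    ae_tendsto_pairCost_of_gt hμ hν hcx hLμ hLν, ae_tendsto_quantile hLμ,
    ae_tendsto_quantile hLν] with u h1 h2 hqμ hqν
  rcases lt_trichotomy (quantile μ u) (quantile ν u) with h | h | h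
  · exact h2 h
  -- With equal quantiles every term of the domination tends to 0, so φ and φ̃ play no role.
  · have h3 := ((ENNReal.tendsto_ofReal (hqμ.sub hqν).abs).add
      (ENNReal.tendsto_ofReal (hqν.sub_const (quantile ν u)).abs)).add_const
      (ENNReal.ofReal |quantile μ u - quantile ν u|)
    simp only [h, sub_self, abs_zero, ENNReal.ofReal_zero, add_zero] at h3
    refine tendsto_of_tendsto_of_tendsto_of_le_of_le tendsto_const_nhds h3 (fun _ => zero_le)
      fun n => (pairCost_le _ _ _ _ u).trans ?_
    simp [h]
  · exact h1 h

theorem tendsto_lintegral_pairCost (hμ : Integrable (fun x : ℝ => x) μ)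
    (hν : Integrable (fun x : ℝ => x) ν) (hcx : ConvexOrderLE μ ν)
    (hLμ : Tendsto (fun n => ∫⁻ u, ENNReal.ofReal |quantile (μs n) u - quantile μ u| ∂unitLaw)
      atTop (𝓝 0))
    (hLν : Tendsto (fun n => ∫⁻ u, ENNReal.ofReal |quantile (νs n) u - quantile ν u| ∂unitLaw)
      atTop (𝓝 0)) :
    Tendsto (fun n => ∫⁻ u, pairCost (μs n) (νs n) μ ν u ∂unitLaw) atTop (𝓝 0) := by
  have hq : ∀ α β : Measure ℝ, Measurable fun u => ENNReal.ofReal |quantile α u - quantile β u| :=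
    fun α β => ((measurable_quantile α).sub (measurable_quantile β)).abs.ennreal_ofReal
  -- In `pairCost_le`, bounding |F_μn⁻¹ - F_νn⁻¹| through F_μ⁻¹ and F_ν⁻¹ gives one more copy of the
  -- limiting gap and of the error on ν, hence the two factors 2.
  refine tendsto_lintegral_of_le_add
    (b := fun u => 2 * ENNReal.ofReal |quantile μ u - quantile ν u|)
    (δ := fun n u => ENNReal.ofReal |quantile (μs n) u - quantile μ u| +
      2 * ENNReal.ofReal |quantile (νs n) u - quantile ν u|)
    (fun n => ?_) ?_ (fun n u => (pairCost_le _ _ _ _ u).trans ?_) ?_ ?_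
    (ae_tendsto_pairCost hμ hν hcx hLμ hLν)
  · refine Measurable.lintegral_prod_right' (f := fun z : ℝ × ℝ => ENNReal.ofReal
      |(uniformPair (μs n) (νs n) z).2 - (uniformPair μ ν z).2|) ?_
    exact ((measurable_uniformPair _ _).snd.sub
      (measurable_uniformPair _ _).snd).abs.ennreal_ofReal
  · exact (hq μ ν).const_mul 2
  · have h2 : (2 : ℝ≥0∞) = ENNReal.ofReal 2 := by simp
    rw [h2, ← ENNReal.ofReal_mul zero_le_two, ← ENNReal.ofReal_mul zero_le_two,
      ← ENNReal.ofReal_add (by positivity) (by positivity),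
      ← ENNReal.ofReal_add (by positivity) (by positivity),
      ← ENNReal.ofReal_add (by positivity) (by positivity),
      ← ENNReal.ofReal_add (by positivity) (by positivity)]
    refine ENNReal.ofReal_le_ofReal ?_
    have h3 := abs_sub_le (quantile (μs n) u) (quantile μ u) (quantile (νs n) u)
    have h4 := abs_sub_le (quantile μ u) (quantile ν u) (quantile (νs n) u)
    rw [abs_sub_comm (quantile ν u)] at h4
    linarith
  · rw [lintegral_const_mul _ (hq μ ν)]
    exact ENNReal.mul_ne_top ENNReal.ofNat_ne_top (lintegral_abs_quantile_sub_lt_top hμ hν).ne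
  · have h := hLμ.add (ENNReal.Tendsto.const_mul (a := (2 : ℝ≥0∞)) hLν (Or.inr ENNReal.ofNat_ne_top))
    rw [mul_zero, add_zero] at h
    refine h.congr fun n => ?_
    rw [lintegral_add_left (hq (μs n) μ),
      lintegral_const_mul _ (hq (νs n) ν)]

end

/-! ### From the averaged cost to the Wasserstein distance in the plane. -/

theorem seminorm_prod_le (N : Seminorm ℝ (ℝ × ℝ)) (z : ℝ × ℝ) :
    N z ≤ N (1, 0) * |z.1| + N (0, 1) * |z.2| := by
  have hz : z = z.1 • (1, 0) + z.2 • (0, 1) := by ext <;> simp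
  calc N z = N (z.1 • (1, 0) + z.2 • (0, 1)) := by rw [← hz]
    _ ≤ N (z.1 • (1, 0)) + N (z.2 • (0, 1)) := map_add_le_add N _ _
    _ = _ := by
      rw [map_smul_eq_mul, map_smul_eq_mul, Real.norm_eq_abs, Real.norm_eq_abs]
      ring

theorem wasserstein1_inverseTransformCoupling_le (N : Seminorm ℝ (ℝ × ℝ))
    (μ ν μ' ν' : Measure ℝ) [IsProbabilityMeasure μ] [IsProbabilityMeasure μ'] :
    wasserstein1 N (inverseTransformCoupling μ ν) (inverseTransformCoupling μ' ν') ≤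
      ENNReal.ofReal (N (1, 0)) *
          ∫⁻ u, ENNReal.ofReal |quantile μ u - quantile μ' u| ∂unitLaw +
        ENNReal.ofReal (N (0, 1)) * ∫⁻ u, pairCost μ ν μ' ν' u ∂unitLaw := by
  have hm := measurable_uniformPair μ ν
  have hm' := measurable_uniformPair μ' ν'
  have hq : Measurable fun u => ENNReal.ofReal |quantile μ u - quantile μ' u| :=
    ((measurable_quantile μ).sub (measurable_quantile μ')).abs.ennreal_ofReal
  have hq' : Measurable fun z : ℝ × ℝ => ENNReal.ofReal |quantile μ z.1 - quantile μ' z.1| :=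
    hq.comp measurable_fst
  have hc : Measurable fun z : ℝ × ℝ =>
      ENNReal.ofReal |(uniformPair μ ν z).2 - (uniformPair μ' ν' z).2| :=
    (hm.snd.sub hm'.snd).abs.ennreal_ofReal
  -- The same two uniform variables drive both pairs.
  let P : Measure ((ℝ × ℝ) × (ℝ × ℝ)) :=
    (unitLaw.prod unitLaw).map fun z => (uniformPair μ ν z, uniformPair μ' ν' z)
  have hP : P ∈ couplings (inverseTransformCoupling μ ν) (inverseTransformCoupling μ' ν') :=
    ⟨(Measure.fst_map_prodMk hm').trans (map_uniformPair μ ν),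
      (Measure.snd_map_prodMk hm).trans (map_uniformPair μ' ν')⟩
  refine (iInf₂_le P hP).trans ((lintegral_map_le _ _).trans ?_)
  calc _ ≤ ∫⁻ z : ℝ × ℝ, (ENNReal.ofReal (N (1, 0)) *
          ENNReal.ofReal |quantile μ z.1 - quantile μ' z.1| + ENNReal.ofReal (N (0, 1)) *
          ENNReal.ofReal |(uniformPair μ ν z).2 - (uniformPair μ' ν' z).2|)
          ∂(unitLaw.prod unitLaw) := by
        refine lintegral_mono fun z => ?_
        have h0 := apply_nonneg N ((1, 0) : ℝ × ℝ)
        have h1 := apply_nonneg N ((0, 1) : ℝ × ℝ)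
        rw [← ENNReal.ofReal_mul h0, ← ENNReal.ofReal_mul h1,
          ← ENNReal.ofReal_add (by positivity) (by positivity)]
        exact ENNReal.ofReal_le_ofReal (seminorm_prod_le N _)
    _ = _ := by
        rw [lintegral_add_right _ (hc.const_mul _), lintegral_const_mul _ hc,
          lintegral_const_mul _ hq', lintegral_prod _ hc.aemeasurable,
          lintegral_prod _ hq'.aemeasurable]
        simp only [lintegral_const, measure_univ, mul_one]
        rfl

end ITMC

theorem mainTheorem7 (μ ν : Measure ℝ) [IsProbabilityMeasure μ] [IsProbabilityMeasure ν]
    (μs νs : ℕ → Measure ℝ) [∀ n, IsProbabilityMeasure (μs n)] [∀ n, IsProbabilityMeasure (νs n)]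
    (hμ : Integrable (fun x : ℝ => x) μ) (hν : Integrable (fun x : ℝ => x) ν)
    (hμs : ∀ n, Integrable (fun x : ℝ => x) (μs n))
    (hνs : ∀ n, Integrable (fun x : ℝ => x) (νs n))
    (hcx : ITMC.ConvexOrderLT μ ν) (hcxs : ∀ n, ITMC.ConvexOrderLT (μs n) (νs n))
    (hWμ : Tendsto (fun n => ITMC.wasserstein1 (normSeminorm ℝ ℝ) (μs n) μ) atTop (𝓝 0))
    (hWν : Tendsto (fun n => ITMC.wasserstein1 (normSeminorm ℝ ℝ) (νs n) ν) atTop (𝓝 0))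
    (N : Seminorm ℝ (ℝ × ℝ)) (hN : ∀ z, N z = 0 → z = 0) :
    Tendsto (fun n => ITMC.wasserstein1 N (ITMC.inverseTransformCoupling (μs n) (νs n))
      (ITMC.inverseTransformCoupling μ ν)) atTop (𝓝 0) := by
  have hLμ : Tendsto (fun n => ∫⁻ u, ENNReal.ofReal
      |ITMC.quantile (μs n) u - ITMC.quantile μ u| ∂ITMC.unitLaw) atTop (𝓝 0) :=
    tendsto_of_tendsto_of_tendsto_of_le_of_le tendsto_const_nhds hWμ (fun _ => zero_le)
      fun n => ITMC.lintegral_abs_quantile_sub_le_wasserstein1 _ _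
  have hLν : Tendsto (fun n => ∫⁻ u, ENNReal.ofReal
      |ITMC.quantile (νs n) u - ITMC.quantile ν u| ∂ITMC.unitLaw) atTop (𝓝 0) :=
    tendsto_of_tendsto_of_tendsto_of_le_of_le tendsto_const_nhds hWν (fun _ => zero_le)
      fun n => ITMC.lintegral_abs_quantile_sub_le_wasserstein1 _ _
  have h := (ENNReal.Tendsto.const_mul (a := ENNReal.ofReal (N (1, 0))) hLμ
    (Or.inr ENNReal.ofReal_ne_top)).add
    (ENNReal.Tendsto.const_mul (a := ENNReal.ofReal (N (0, 1)))
      (ITMC.tendsto_lintegral_pairCost hμ hν hcx.1 hLμ hLν) (Or.inr ENNReal.ofReal_ne_top))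
  rw [mul_zero, mul_zero, add_zero] at h
  exact tendsto_of_tendsto_of_tendsto_of_le_of_le tendsto_const_nhds h (fun _ => zero_le)
    fun n => ITMC.wasserstein1_inverseTransformCoupling_le N _ _ _ _
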